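/- Let $\alpha>-1$, $c>0$, let $\mathbb B=\{x\in\mathbb R^3:\|x\|\le 1\}$ and $\varpi_\alpha(x)=(1-\|x\|^2)^\alpha$. For scalar or vector fields $f$ on $\mathbb B$ put $$\mathscr F_c^{(\alpha)}[f](x)=\int_{\mathbb B}e^{-\mathrm i c\langle x,\tau\rangle}f(\tau)\,\varpi_\alpha(\tau)\,d\tau .$$ For $n\ge 0$ and $1\le\ell\le 2n+1$ let $Y_\ell^n$ be the real harmonic polynomials which in spherical coordinates $x=(r\sin\theta\cos\phi,r\sin\theta\sin\phi,r\cos\theta)$ are $$Y_1^n=\tfrac{r^n}{\sqrt{8\pi}}J_n^{(0,0)}(\cos\theta),\quad Y_{2m}^n=\tfrac{r^n}{2^{m+1}\sqrt\pi}(\sin\theta)^mJ_{n-m}^{(m,m)}(\cos\theta)\cos m\phi,\quad Y_{2m+1}^n=\tfrac{r^n}{2^{m+1}\sqrt\pi}(\sin\theta)^mJ_{n-m}^{(m,m)}(\cos\theta)\sin m\phi$$ for $1\le m\le n$, where $J_k^{(m,m)}$ is the Jacobi polynomial with positive leading coefficient normalized by $\int_{-1}^1 (J_k^{(m,m)})^2(1-\eta^2)^m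 d\eta=2^{2m+2}$. Let $\psi_{k,\ell}^{\alpha,n}(x;c)=\phi_k^{\alpha,n}(2\|x\|^2-1;c)\,Y_\ell^n(x)$, $n,k\ge 0$, $1\le \ell\le 2n+1$, be the (a priori complex-valued) scalar ball prolate spheroidal wave functions: they lie in $L^2_{\varpi_\alpha}(\mathbb B)$, satisfy $$\mathscr F_c^{(\alpha)}[\psi_{k,\ell}^{\alpha,n}]=(-\mathrm i)^{n+2k}\lambda_{n,k}\,\psi_{k,\ell}^{\alpha,n}\ \text{ on }\mathbb B,\qquad \lambda_{n,k}>0,$$ are normalized by $\int_{\mathbb B}(\psi_{k,\ell}^{\alpha,n})^2\varpi_\alpha\,dx=1$, and are arranged in $k$, for each $n$, in one of the following two ways: (a) $\lambda_{n,0}>\lambda_{n,1}>\cdots$, and for each $\ell$ every eigenfunction in $L^2_{\varpi_\alpha}(\mathbb B)$ of $\mathscr F_c^{(\alpha)}$ of the form $g(2\|x\|^2-1)Y_\ell^n(x)$ with a nonzero eigenvalue is a scalar multiple of some $\psi_{k,\ell}^{\alpha,n}$; or (b) $\mathscr L\psi_{k,\ell}^{\alpha,n}=\chi_{n,k}\psi_{k,\ell}^{\alpha,n}$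 for $\|x\|<1$ with real $\chi_{n,0}<\chi_{n,1}<\cdots$, where $\mathscr L=-(1-\|x\|^2)^{-\alpha}\nabla\cdot(\mathbf I-xx^{\mathsf t})(1-\|x\|^2)^{\alpha}\nabla+c^2\|x\|^2$, and for each $\ell$ every eigenfunction of $\mathscr L$ of the form $g(2\|x\|^2-1)Y_\ell^n(x)$ that is smooth on $\mathbb B$ is a scalar multiple of some $\psi_{k,\ell}^{\alpha,n}$. For $n\ge1$, $1\le\ell\le 2n+1$, $k\ge 0$, let $\boldsymbol\psi_{k,\ell}^{\alpha,n}=(x\times\nabla)\psi_{k,\ell}^{\alpha,n}$ be the divergence-free ball PSWFs. Then they satisfy $\nabla\cdot\boldsymbol\psi_{k,\ell}^{\alpha,n}=0$ in the open ball and $\mathscr F_c^{(\alpha)}[\boldsymbol\psi_{k,\ell}^{\alpha,n}]=(-\mathrm i)^{n+2k}\lambda_{n,k}\boldsymbol\psi_{k,\ell}^{\alpha,n}$ on $\mathbb B$; they are real-valued and $C^\infty$ on $\mathbb B$, belong to $L^2_{\varpi_\alpha}(\mathbb B)^3$, and are mutually orthogonal there: $$\int_{\mathbb B}\boldsymbol\psi_{k,\ell}^{\alpha,n}\cdot\boldsymbol\psi_{j,\iota}^{\alpha,m}\,\varpi_\alpha\,dx=n(n+1)\,\delta_{k,j}\,\delta_{\ell,\iota}\,\delta_{n,m}$$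 for all $n,m\ge1$, $1\le\ell\le2n+1$, $1\le\iota\le2m+1$, $k,j\ge0$. -/

import Mathlib

open MeasureTheory Matrix
open scoped ContDiff

noncomputable section

namespace BallPSWF

/-- Three-dimensional Euclidean space. -/
abbrev E3 : Type := EuclideanSpace ℝ (Fin 3)

/-- The closed unit ball of `ℝ³`. -/
def ball : Set E3 := Metric.closedBall 0 1

/-- The measure `(1 - ‖x‖²)^α dx` on the closed unit ball. -/
def weight (α : ℝ) : Measure E3 :=
  (volume.restrict ball).withDensity fun x => ENNReal.ofReal ((1 - ‖x‖ ^ 2) ^ α)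

/-- The finite Fourier transform
`F_c^{(α)}[f](x) = ∫_{‖τ‖ ≤ 1} e^{-i c ⟨x, τ⟩} f(τ) (1 - ‖τ‖²)^α dτ`,
for scalar fields (`V = ℂ`) as well as for vector fields (`V = Fin 3 → ℂ`). -/
def finiteFourier {V : Type*} [NormedAddCommGroup V] [NormedSpace ℂ V]
    (α c : ℝ) (f : E3 → V) (x : E3) : V :=
  ∫ τ, Complex.exp (-(Complex.I * (c : ℂ) * ((inner ℝ x τ : ℝ) : ℂ))) • f τ ∂(weight α)

/-! ### Spherical harmonics -/

/-- The classical Jacobi polynomial `P_k^{(m,m)}(η)`, for a natural number `m`. -/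
def classicalJacobi (k m : ℕ) (η : ℝ) : ℝ :=
  ∑ s ∈ Finset.range (k + 1), ((k + m).choose (k - s) : ℝ) * ((k + m).choose s : ℝ) *
    ((η - 1) / 2) ^ s * ((η + 1) / 2) ^ (k - s)

/-- The normalized Jacobi polynomial `J_k^{(m,m)}(η) = P_k^{(m,m)}(η) / h_k^{(m,m)}`, for which
`∫_{-1}^{1} (J_k^{(m,m)})² (1 - η²)^m dη = 2^{2m+2}`. -/
def jacobi (k m : ℕ) (η : ℝ) : ℝ :=
  classicalJacobi k m η /
    √(((k + m).factorial : ℝ) ^ 2 /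
      (2 * (2 * k + 2 * m + 1) * (k.factorial : ℝ) * ((k + 2 * m).factorial : ℝ)))

/-- The real harmonic polynomials `Y_ℓ^n`, `1 ≤ ℓ ≤ 2 n + 1`, whose restrictions to the unit
sphere are the orthonormal real spherical harmonics of degree `n`.  In spherical coordinates
`x = (r sin θ cos ϕ, r sin θ sin ϕ, r cos θ)`,
* `Y_1^n = r^n / √(8π) * J_n^{(0,0)}(cos θ)`,
* `Y_{2m}^n = r^n / (2^{m+1} √π) * (sin θ)^m J_{n-m}^{(m,m)}(cos θ) cos (m ϕ)`,
* `Y_{2m+1}^n = r^n / (2^{m+1} √π) * (sin θ)^m J_{n-m}^{(m,m)}(cos θ) sin (m ϕ)`,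
for `1 ≤ m ≤ n`.  Here `cos θ = x₃ / r`, and `r^m (sin θ)^m cos (m ϕ)` and
`r^m (sin θ)^m sin (m ϕ)` are the real and the imaginary part of `(x₁ + i x₂)^m`. -/
def harmonicY (n l : ℕ) (x : E3) : ℝ :=
  if l = 1 then ‖x‖ ^ n / √(8 * Real.pi) * jacobi n 0 (x 2 / ‖x‖)
  else
    ‖x‖ ^ (n - l / 2) / (2 ^ (l / 2 + 1) * √Real.pi) * jacobi (n - l / 2) (l / 2) (x 2 / ‖x‖) *
      (if Even l then ((⟨x 0, x 1⟩ : ℂ) ^ (l / 2)).re else ((⟨x 0, x 1⟩ : ℂ) ^ (l / 2)).im)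

/-- The scalar field `g(2 ‖x‖² - 1) Y_ℓ^n(x)`. -/
def sectorFun (g : ℝ → ℂ) (n l : ℕ) (x : E3) : ℂ :=
  g (2 * ‖x‖ ^ 2 - 1) * (harmonicY n l x : ℂ)

/-! ### Differential operators -/

/-- The partial derivative `∂_i f` (meant for interior points of the domain of `f`). -/
def partialD (i : Fin 3) (f : E3 → ℂ) (x : E3) : ℂ :=
  fderiv ℝ f x (EuclideanSpace.single i 1)

/-- The divergence of a vector field. -/
def divergence (V : E3 → Fin 3 → ℂ) (x : E3) : ℂ :=
  ∑ i, partialD i (fun y => V y i) x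

/-- The Sturm-Liouville operator
`L f = -(1 - ‖x‖²)^{-α} ∇ · ((I - x xᵗ) (1 - ‖x‖²)^α ∇ f) + c² ‖x‖² f`. -/
def sturmLiouville (α c : ℝ) (f : E3 → ℂ) (x : E3) : ℂ :=
  -(((1 - ‖x‖ ^ 2) ^ (-α) : ℝ) : ℂ) *
      divergence (fun y i => (((1 - ‖y‖ ^ 2) ^ α : ℝ) : ℂ) *
        (partialD i f y - (y i : ℂ) * ∑ j, (y j : ℂ) * partialD j f y)) x +
    ((c ^ 2 * ‖x‖ ^ 2 : ℝ) : ℂ) * f x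

/-- The gradient of a function on the closed unit ball (one-sided at the boundary). -/
def gradBall (f : E3 → ℂ) (x : E3) : Fin 3 → ℂ :=
  fun i => fderivWithin ℝ f ball x (EuclideanSpace.single i 1)

/-- The vector field `(x × ∇) f` on the closed unit ball. -/
def crossGrad (f : E3 → ℂ) (x : E3) : Fin 3 → ℂ :=
  (fun i => (x i : ℂ)) ⨯₃ gradBall f x

/-! ### Ball prolate spheroidal wave functions -/

/-- Arrangement by the moduli of the eigenvalues: for the given `n` the moduli `lam 0, lam 1, …`
decrease strictly, and the functions `φ_k(2 ‖x‖² - 1) Y_ℓ^n(x)` are, up to scalar multiples, all the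
eigenfunctions of the finite Fourier transform of the form `g(2 ‖x‖² - 1) Y_ℓ^n(x)`. -/
def ArrangedByModulus (α c : ℝ) (n : ℕ) (φ : ℕ → ℝ → ℂ) (lam : ℕ → ℝ) : Prop :=
  StrictAnti lam ∧
  ∀ (l : ℕ), 1 ≤ l → l ≤ 2 * n + 1 → ∀ (g : ℝ → ℂ) (μ : ℂ), μ ≠ 0 →
    MemLp (sectorFun g n l) 2 (weight α) →
    (∀ x ∈ ball, finiteFourier α c (sectorFun g n l) x = μ * sectorFun g n l x) →
    ∃ (k : ℕ) (z : ℂ), ∀ x ∈ ball, sectorFun g n l x = z * sectorFun (φ k) n l x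

/-- Arrangement by the eigenvalues of the Sturm-Liouville operator: for the given `n` the functions
`φ_k(2 ‖x‖² - 1) Y_ℓ^n(x)` are eigenfunctions of it with real eigenvalues `χ_0 < χ_1 < …`, and
up to scalar multiples they are all its eigenfunctions of the form `g(2 ‖x‖² - 1) Y_ℓ^n(x)`
that are smooth on the closed ball. -/
def ArrangedBySturmLiouville (α c : ℝ) (n : ℕ) (φ : ℕ → ℝ → ℂ) : Prop :=
  ∃ χ : ℕ → ℝ, StrictMono χ ∧
    ∀ (l : ℕ), 1 ≤ l → l ≤ 2 * n + 1 →
      (∀ k, ∀ x ∈ Metric.ball (0 : E3) 1,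
        sturmLiouville α c (sectorFun (φ k) n l) x = (χ k : ℂ) * sectorFun (φ k) n l x) ∧
      ∀ (g : ℝ → ℂ) (μ : ℂ), ContDiffOn ℝ ∞ (sectorFun g n l) ball →
        (∀ x ∈ Metric.ball (0 : E3) 1,
          sturmLiouville α c (sectorFun g n l) x = μ * sectorFun g n l x) →
        ∃ (k : ℕ) (z : ℂ), ∀ x ∈ ball, sectorFun g n l x = z * sectorFun (φ k) n l x

/-- `IsBallPSWF α c φ lam`: the functions `ψ_{k,ℓ}^n(x) = φ n k (2 ‖x‖² - 1) Y_ℓ^n(x)` on the closed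
unit ball, `n, k ≥ 0`, `1 ≤ ℓ ≤ 2 n + 1`, are the scalar ball prolate spheroidal wave functions of
order `α` and bandwidth `c`: square integrable eigenfunctions of the finite Fourier transform with
eigenvalues `(-i)^{n+2k} lam n k`, `lam n k > 0`, normalized with respect to the bilinear form
`(f, g) = ∫ f g (1 - ‖x‖²)^α`, and arranged in `k`, for each `n`, in one of the two usual ways.
They may be complex valued. -/
structure IsBallPSWF (α c : ℝ) (φ : ℕ → ℕ → ℝ → ℂ) (lam : ℕ → ℕ → ℝ) : Prop where
  lam_pos : ∀ n k, 0 < lam n k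
  memLp : ∀ n k l, 1 ≤ l → l ≤ 2 * n + 1 → MemLp (sectorFun (φ n k) n l) 2 (weight α)
  eigen : ∀ n k l, 1 ≤ l → l ≤ 2 * n + 1 → ∀ x ∈ ball,
    finiteFourier α c (sectorFun (φ n k) n l) x =
      ((-Complex.I) ^ (n + 2 * k) * (lam n k : ℂ)) * sectorFun (φ n k) n l x
  normalized : ∀ n k l, 1 ≤ l → l ≤ 2 * n + 1 →
    ∫ x, sectorFun (φ n k) n l x * sectorFun (φ n k) n l x ∂(weight α) = 1
  arranged : ∀ n, ArrangedByModulus α c n (φ n) (lam n) ∨ ArrangedBySturmLiouville α c n (φ n)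

/-- The divergence free ball prolate spheroidal wave function
`𝛙_{k,ℓ}^n = (x × ∇) ψ_{k,ℓ}^n` on the closed unit ball. -/
def divFreePSWF (φ : ℕ → ℕ → ℝ → ℂ) (n k l : ℕ) : E3 → Fin 3 → ℂ :=
  crossGrad (sectorFun (φ n k) n l)

end BallPSWF

end

namespace BallPSWF

open Filter Topology Set

/-! ### The weighted measure on the ball -/

/-! The components `rotD i` of `x × ∇` are infinitesimal rotations: divergence-free fields tangent
to every sphere about the origin. Three properties of them carry the theorem. They are
skew-symmetric for the weighted bilinear form (`integral_rotD_mul`), since the weight is radial and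
no boundary flux survives. They commute with the finite Fourier transform (`finiteFourier_rotD`),
whose kernel depends only on `⟨x, τ⟩`. The sum of their squares is the spherical Laplacian, which
acts on `g(2‖x‖² - 1) Y_ℓ^n` as `-n(n+1)` (`casimir_extension`).

Commutation transports the scalar eigenrelation to the vector fields. Skew-symmetry and the Casimir
identity turn the vector inner product into `n(n+1)` times the scalar one; the same computation with
the roles exchanged gives `m(m+1)`, so different degrees are orthogonal. Within one degree the
scalar functions are orthogonal for three reasons: the rotation about the third axis separates the
azimuthal orders `l / 2` and, within an order, cosine from sine; symmetry of the Fourier transform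
or of the Sturm-Liouville operator, according to the arrangement, separates `k` from `j`.

Smoothness is not assumed of `φ`. As the eigenvalue is nonzero, the Fourier transform of the wave
function divided by it is a smooth extension to all of space (`exists_extension`), and all calculus
is done on that extension. Reality follows because the conjugate lies in the same sector with the
same eigenvalue; completeness makes it a multiple `z` of the function itself, and the normalization
forces `z = 1` (`conj_wave`). -/

theorem integrableOn_radial_weight {α : ℝ} (hα : -1 < α) :
    IntegrableOn (fun x : E3 => (1 - ‖x‖ ^ 2) ^ α) (Metric.ball 0 1) := by
  rw [integrableOn_fun_norm_addHaar volume (f := fun r : ℝ => (1 - r ^ 2) ^ α)]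
  have h1 : IntegrableOn (fun t : ℝ => t ^ α) (Ioo 0 1) :=
    (intervalIntegral.integrableOn_Ioo_rpow_iff zero_lt_one).2 hα
  have h2 : IntegrableOn (fun t : ℝ => (1 - t) ^ α) (Ioo 0 1) := by
    have h3 : IntervalIntegrable (fun t : ℝ => t ^ α) volume 0 1 :=
      intervalIntegral.intervalIntegrable_rpow' hα
    have h4 := (h3.comp_sub_left 1).symm
    simp only [sub_zero, sub_self] at h4
    rw [intervalIntegrable_iff_integrableOn_Ioo_of_le zero_le_one] at h4
    exact h4
  -- In polar coordinates `1 - t² = (1 + t)(1 - t)`, and only `(1 - t) ^ α` can be singular on `[0,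
  -- 1]`; it is integrable because `-1 < α`.
  have h5 : IntegrableOn (fun t : ℝ => (t ^ 2 * (1 + t) ^ α) * (1 - t) ^ α) (Icc 0 1) := by
    refine IntegrableOn.continuousOn_mul ?_ 
      (integrableOn_Icc_iff_integrableOn_Ioo (by simp) (by simp) |>.2 h2)
      isCompact_Icc
    refine ContinuousOn.mul (by fun_prop) (ContinuousOn.rpow_const (by fun_prop) ?_)
    intro t ht
    left
    linarith [ht.1]
  refine (h5.mono_set Ioo_subset_Icc_self).congr_fun ?_ measurableSet_Ioo
  intro t ht
  have e : (1 - t ^ 2 : ℝ) = (1 + t) * (1 - t) := by ring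
  simp only [finrank_euclideanSpace, Fintype.card_fin, smul_eq_mul]
  rw [e, Real.mul_rpow (by linarith [ht.1]) (by linarith [ht.2])]
  ring

theorem ball_ae_eq : (ball : Set E3) =ᵐ[volume] Metric.ball 0 1 := by
  have h : ball \ Metric.ball (0 : E3) 1 = Metric.sphere 0 1 := by
    rw [ball, Metric.closedBall_sdiff_ball]
  refine (ae_eq_set.2 ⟨?_, ?_⟩)
  · rw [h, Measure.addHaar_sphere]
  · rw [ball, sdiff_eq_empty.2 Metric.ball_subset_closedBall, measure_empty]

theorem volume_restrict_ball :
    (volume : Measure E3).restrict ball = volume.restrict (Metric.ball 0 1) :=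
  Measure.restrict_congr_set ball_ae_eq

theorem isFiniteMeasure_weight {α : ℝ} (hα : -1 < α) : IsFiniteMeasure (weight α) := by
  rw [weight, volume_restrict_ball]
  exact isFiniteMeasure_withDensity_ofReal (integrableOn_radial_weight hα).2

theorem ae_mem_openBall (α : ℝ) : ∀ᵐ x ∂weight α, x ∈ Metric.ball (0 : E3) 1 := by
  rw [weight, volume_restrict_ball]
  exact (withDensity_absolutelyContinuous _ _).ae_le (ae_restrict_mem Metric.isOpen_ball.measurableSet)

theorem openBall_subset : Metric.ball (0 : E3) 1 ⊆ ball := Metric.ball_subset_closedBall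

theorem ae_mem_ball (α : ℝ) : ∀ᵐ x ∂weight α, x ∈ ball :=
  (ae_mem_openBall α).mono fun _ hx => openBall_subset hx

theorem norm_sq_le_one {x : E3} (hx : x ∈ ball) : ‖x‖ ^ 2 ≤ 1 := by
  have h : ‖x‖ ≤ 1 := by simpa [ball] using hx
  nlinarith [norm_nonneg x]

theorem norm_sq_lt_one {x : E3} (hx : x ∈ Metric.ball (0 : E3) 1) : ‖x‖ ^ 2 < 1 := by
  have h : ‖x‖ < 1 := by simpa using hx
  nlinarith [norm_nonneg x]

theorem integral_weight {E : Type*} [NormedAddCommGroup E] [NormedSpace ℝ E] (α : ℝ)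
    (f : E3 → E) :
    ∫ x, f x ∂weight α = ∫ x in ball, ((1 - ‖x‖ ^ 2) ^ α) • f x := by
  rw [weight, integral_withDensity_eq_integral_toReal_smul (by fun_prop) (by simp)]
  refine setIntegral_congr_fun Metric.isClosed_closedBall.measurableSet fun x hx => ?_
  have h : 0 ≤ 1 - ‖x‖ ^ 2 := by linarith [norm_sq_le_one hx]
  simp only [ENNReal.toReal_ofReal (Real.rpow_nonneg h α)]

theorem exists_bound_on_ball {E : Type*} [NormedAddCommGroup E] {f : E3 → E}
    (hf : Continuous f) : ∃ C, ∀ x ∈ ball, ‖f x‖ ≤ C :=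
  (isCompact_closedBall (0 : E3) 1).exists_bound_of_continuousOn hf.continuousOn

theorem memLp_of_continuous {E : Type*} [NormedAddCommGroup E] {α : ℝ} (hα : -1 < α)
    {f : E3 → E} (hf : Continuous f) (p : ENNReal) : MemLp f p (weight α) := by
  have := isFiniteMeasure_weight hα
  obtain ⟨C, hC⟩ := exists_bound_on_ball hf
  exact MemLp.of_bound hf.aestronglyMeasurable C ((ae_mem_ball α).mono fun x hx => hC x hx)

theorem integrable_of_continuous {E : Type*} [NormedAddCommGroup E] {α : ℝ} (hα : -1 < α)
    {f : E3 → E} (hf : Continuous f) : Integrable f (weight α) :=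
  memLp_one_iff_integrable.1 (memLp_of_continuous hα hf 1)

/-! ### Integration by parts on the ball -/

/-- The function `t ^ α`, cut off smoothly near `t ≤ 0`. -/
noncomputable def cutPow (α : ℝ) (N : ℕ) (t : ℝ) : ℝ := Real.smoothTransition (N * t - 1) * t ^ α

/-- The boundary layer profile of the cut-offs. -/
noncomputable def layer (s : ℝ) : ℝ := s * deriv Real.smoothTransition (s - 1)

theorem continuous_layer : Continuous layer := by
  have h : Continuous (deriv Real.smoothTransition) :=
    (Real.smoothTransition.contDiff (n := 1)).continuous_deriv le_rfl
  unfold layer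
  fun_prop

theorem layer_eq_zero_of_lt {s : ℝ} (hs : s < 1) : layer s = 0 := by
  have : Real.smoothTransition =ᶠ[𝓝 (s - 1)] fun _ => 0 := by
    filter_upwards [gt_mem_nhds (show s - 1 < 0 by linarith)] with t ht
    exact Real.smoothTransition.zero_of_nonpos ht.le
  rw [layer, this.deriv_eq, deriv_const, mul_zero]

theorem layer_eq_zero_of_gt {s : ℝ} (hs : 2 < s) : layer s = 0 := by
  have : Real.smoothTransition =ᶠ[𝓝 (s - 1)] fun _ => 1 := by
    filter_upwards [lt_mem_nhds (show 1 < s - 1 by linarith)] with t ht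
    exact Real.smoothTransition.one_of_one_le (le_of_lt ht)
  rw [layer, this.deriv_eq, deriv_const, mul_zero]

theorem exists_layer_bound : ∃ C, ∀ s, ‖layer s‖ ≤ C := by
  obtain ⟨C, hC⟩ := (isCompact_Icc (a := (1 : ℝ)) (b := 2)).exists_bound_of_continuousOn
    continuous_layer.continuousOn
  refine ⟨max C 0, fun s => ?_⟩
  by_cases h1 : s < 1
  · simp [layer_eq_zero_of_lt h1]
  by_cases h2 : 2 < s
  · simp [layer_eq_zero_of_gt h2]
  · exact (hC s ⟨not_lt.1 h1, not_lt.1 h2⟩).trans (le_max_left _ _)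

theorem cutPow_eventually_zero (α : ℝ) (N : ℕ) {t : ℝ} (ht : t ≤ 0) :
    cutPow α N =ᶠ[𝓝 t] fun _ => 0 := by
  have h : Tendsto (fun s : ℝ => (N : ℝ) * s - 1) (𝓝 t) (𝓝 (N * t - 1)) :=
    Continuous.tendsto (by fun_prop) t
  have h2 : (N : ℝ) * t - 1 < 0 := by
    have : (N : ℝ) * t ≤ 0 := mul_nonpos_of_nonneg_of_nonpos (Nat.cast_nonneg N) ht
    linarith
  filter_upwards [h.eventually (gt_mem_nhds h2)] with s hs
  rw [cutPow, Real.smoothTransition.zero_of_nonpos (le_of_lt hs), zero_mul]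

theorem cutPow_of_nonpos (α : ℝ) (N : ℕ) {t : ℝ} (ht : t ≤ 0) : cutPow α N t = 0 :=
  (cutPow_eventually_zero α N ht).self_of_nhds

theorem contDiff_cutPow (α : ℝ) (N : ℕ) : ContDiff ℝ 1 (cutPow α N) := by
  rw [contDiff_iff_contDiffAt]
  intro t
  rcases le_or_gt t 0 with ht | ht
  · exact contDiffAt_const.congr_of_eventuallyEq (cutPow_eventually_zero α N ht)
  · have h1 : ContDiffAt ℝ 1 (fun s : ℝ => s ^ α) t :=
      contDiffAt_id.rpow_const_of_ne ht.ne'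
    have h2 : ContDiff ℝ 1 (fun s : ℝ => Real.smoothTransition (N * s - 1)) :=
      Real.smoothTransition.contDiff.comp (by fun_prop)
    exact h2.contDiffAt.mul h1

theorem deriv_cutPow_of_nonpos (α : ℝ) (N : ℕ) {t : ℝ} (ht : t ≤ 0) :
    deriv (cutPow α N) t = 0 := by
  rw [(cutPow_eventually_zero α N ht).deriv_eq, deriv_const]

/-- The factor `t` absorbs the large factor `N` of the derivative of the cut-off: it becomes `layer
(N * t)`, bounded uniformly in `N`. This allows a limit even for negative `α`. -/
theorem mul_deriv_cutPow (α : ℝ) (N : ℕ) {t : ℝ} (ht : 0 < t) :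
    t * deriv (cutPow α N) t =
      t ^ α * (layer (N * t) + α * Real.smoothTransition (N * t - 1)) := by
  have h1 : HasDerivAt (fun s : ℝ => s ^ α) (α * t ^ (α - 1)) t :=
    Real.hasDerivAt_rpow_const (Or.inl ht.ne')
  have h2 : HasDerivAt Real.smoothTransition (deriv Real.smoothTransition (N * t - 1))
      (N * t - 1) :=
    ((Real.smoothTransition.contDiff (n := 1)).differentiable (by simp) _).hasDerivAt
  have h3 : HasDerivAt (fun s : ℝ => (N : ℝ) * s - 1) N t := by
    simpa using ((hasDerivAt_id t).const_mul (N : ℝ)).sub_const 1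
  have h4 := (h2.comp t h3).mul h1
  have h5 : deriv (cutPow α N) t = _ := h4.deriv
  rw [h5, Real.rpow_sub_one ht.ne', layer]
  simp only [Function.comp]
  field_simp

theorem fderiv_norm_sq_single (x : E3) (g : ℝ → ℝ) (hg : DifferentiableAt ℝ g (1 - ‖x‖ ^ 2)) (i : Fin 3) :
    fderiv ℝ (fun y : E3 => ((g (1 - ‖y‖ ^ 2) : ℝ) : ℂ)) x (EuclideanSpace.single i 1) =
      ((-2 * deriv g (1 - ‖x‖ ^ 2) * x i : ℝ) : ℂ) := by
  have h1 : HasFDerivAt (fun y : E3 => 1 - ‖y‖ ^ 2) (-(2 • (innerSL ℝ x))) x :=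
    (hasStrictFDerivAt_norm_sq x).hasFDerivAt.const_sub 1
  have h2 := hg.hasDerivAt.comp_hasFDerivAt x h1
  have h3 := (Complex.ofRealCLM.hasFDerivAt).comp x h2
  have h4 : fderiv ℝ (fun y : E3 => ((g (1 - ‖y‖ ^ 2) : ℝ) : ℂ)) x = _ := h3.fderiv
  rw [h4]
  simp [EuclideanSpace.inner_single_right]
  ring

/-- The cut-off weight is `C¹` with compact support, so ordinary integration by parts applies. Its
gradient is radial, so it meets `V` only through `∑ x i * V x i`; the assumed factor `1 - ‖x‖²` is
the `t` needed in `mul_deriv_cutPow`. -/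
theorem integral_cutPow_divergence (α : ℝ) (N : ℕ) {V : E3 → Fin 3 → ℂ} {q : E3 → ℂ}
    (hV : ∀ i, ContDiff ℝ 1 fun x => V x i)
    (hVq : ∀ x, ∑ i, (x i : ℂ) * V x i = (1 - ‖x‖ ^ 2 : ℝ) * q x) :
    ∫ x, ((Real.smoothTransition (N * (1 - ‖x‖ ^ 2) - 1) : ℝ) : ℂ) *
        (divergence V x - 2 * α * q x) - 2 * (layer (N * (1 - ‖x‖ ^ 2)) : ℝ) * q x ∂weight α
      = 0 := by
  set ρ : E3 → ℂ := fun y => ((cutPow α N (1 - ‖y‖ ^ 2) : ℝ) : ℂ) with hρ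
  have hρd : ContDiff ℝ 1 ρ :=
    Complex.ofRealCLM.contDiff.comp ((contDiff_cutPow α N).comp
      (contDiff_const.sub (contDiff_norm_sq ℝ)))
  have hzero : ∀ x : E3, x ∉ ball → 1 - ‖x‖ ^ 2 ≤ 0 := by
    intro x hx
    have : 1 < ‖x‖ := by simpa [ball] using hx
    nlinarith
  have hρs : HasCompactSupport ρ := by
    refine HasCompactSupport.intro (isCompact_closedBall (0 : E3) 1) fun x hx => ?_
    simp only [hρ, cutPow_of_nonpos α N (hzero x hx), Complex.ofReal_zero]
  have hρ'c : ∀ i : Fin 3, Continuous fun x => fderiv ℝ ρ x (EuclideanSpace.single i 1) :=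
    fun i => (hρd.continuous_fderiv (by simp)).clm_apply continuous_const
  have hV'c : ∀ i : Fin 3, Continuous fun x =>
      fderiv ℝ (fun y => V y i) x (EuclideanSpace.single i 1) :=
    fun i => ((hV i).continuous_fderiv (by simp)).clm_apply continuous_const
  have hint1 : ∀ i : Fin 3, Integrable fun x =>
      fderiv ℝ ρ x (EuclideanSpace.single i 1) * V x i := fun i =>
    ((hρ'c i).mul (hV i).continuous).integrable_of_hasCompactSupport
      ((hρs.fderiv_apply ℝ _).mul_right)
  have hint2 : ∀ i : Fin 3, Integrable fun x =>
      ρ x * fderiv ℝ (fun y => V y i) x (EuclideanSpace.single i 1) := fun i =>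
    (hρd.continuous.mul (hV'c i)).integrable_of_hasCompactSupport hρs.mul_right
  have hparts : ∀ i : Fin 3, ∫ x, (ρ x * fderiv ℝ (fun y => V y i) x (EuclideanSpace.single i 1)
      + fderiv ℝ ρ x (EuclideanSpace.single i 1) * V x i) = 0 := by
    intro i
    rw [integral_add (hint2 i) (hint1 i), integral_mul_fderiv_eq_neg_fderiv_mul_of_integrable
      (hint1 i) (hint2 i) ((hρd.continuous.mul (hV i).continuous).integrable_of_hasCompactSupport
        hρs.mul_right) (fun x _ => hρd.differentiable (by simp) x)
        (fun x _ => (hV i).differentiable (by simp) x)]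
    simp
  have hsum : ∫ x, ∑ i : Fin 3, (ρ x * fderiv ℝ (fun y => V y i) x (EuclideanSpace.single i 1)
      + fderiv ℝ ρ x (EuclideanSpace.single i 1) * V x i) = 0 := by
    rw [integral_finsetSum _ fun i _ => by exact (hint2 i).add (hint1 i)]
    simp [hparts]
  have hpt : ∀ x, ∑ i : Fin 3, (ρ x * fderiv ℝ (fun y => V y i) x (EuclideanSpace.single i 1)
      + fderiv ℝ ρ x (EuclideanSpace.single i 1) * V x i) =
      ρ x * divergence V x -
        2 * ((1 - ‖x‖ ^ 2) * deriv (cutPow α N) (1 - ‖x‖ ^ 2) : ℝ) * q x := by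
    intro x
    have e1 : ∀ i : Fin 3, fderiv ℝ ρ x (EuclideanSpace.single i 1) * V x i =
        (-2 * deriv (cutPow α N) (1 - ‖x‖ ^ 2) : ℝ) * ((x i : ℂ) * V x i) := by
      intro i
      rw [hρ, fderiv_norm_sq_single x _ ((contDiff_cutPow α N).differentiable (by simp) _)]
      push_cast
      ring
    rw [Finset.sum_add_distrib, ← Finset.mul_sum, Finset.sum_congr rfl fun i _ => e1 i,
      ← Finset.mul_sum, hVq]
    simp only [divergence, partialD]
    push_cast
    ring
  simp only [hpt] at hsum
  rw [integral_weight, ← hsum, ← setIntegral_univ (μ := volume) (f := fun x => ρ x * _ - _)]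
  rw [setIntegral_eq_of_subset_of_forall_sdiff_eq_zero MeasurableSet.univ (subset_univ ball)]
  · refine setIntegral_congr_fun Metric.isClosed_closedBall.measurableSet fun x hx => ?_
    -- On the sphere the value given to `0 ^ α` does not matter, since cut-off and layer both vanish
    -- there.
    rcases (sub_nonneg.2 (norm_sq_le_one hx)).eq_or_lt with h | h
    · simp only [hρ, ← h]
      rw [cutPow_of_nonpos α N le_rfl, Real.smoothTransition.zero_of_nonpos (by simp),
        layer_eq_zero_of_lt (by simp)]
      simp
    · simp only [hρ, mul_deriv_cutPow α N h]
      rw [cutPow, Complex.real_smul]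
      push_cast
      ring
  · intro x hx
    simp only [hρ, cutPow_of_nonpos α N (hzero x hx.2), deriv_cutPow_of_nonpos α N (hzero x hx.2)]
    simp

/-- The divergence theorem on the ball, for a vector field whose normal component vanishes on the
boundary. -/
theorem integral_divergence_weight {α : ℝ} (hα : -1 < α) {V : E3 → Fin 3 → ℂ} {q : E3 → ℂ}
    (hV : ∀ i, ContDiff ℝ 1 fun x => V x i) (hq : Continuous q)
    (hVq : ∀ x, ∑ i, (x i : ℂ) * V x i = (1 - ‖x‖ ^ 2 : ℝ) * q x) :
    ∫ x, (divergence V x - 2 * α * q x) ∂weight α = 0 := by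
  have := isFiniteMeasure_weight hα
  have hdc : Continuous fun x => divergence V x - 2 * α * q x := by
    refine Continuous.sub (continuous_finsetSum _ fun i _ => ?_) (by fun_prop)
    exact ((hV i).continuous_fderiv (by simp)).clm_apply continuous_const
  obtain ⟨M, hM⟩ := exists_bound_on_ball hdc
  obtain ⟨K, hK⟩ := exists_layer_bound
  obtain ⟨Q, hQ⟩ := exists_bound_on_ball hq
  -- Dominated convergence: at an interior point the cut-off is eventually `1` and the layer, which
  -- lives on `1 ≤ N * (1 - ‖x‖²) ≤ 2`, is eventually `0`.
  have hlim : Tendsto (fun N : ℕ => ∫ x, (((Real.smoothTransition (N * (1 - ‖x‖ ^ 2) - 1) : ℝ) : ℂ) *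
        (divergence V x - 2 * α * q x) - 2 * (layer (N * (1 - ‖x‖ ^ 2)) : ℝ) * q x) ∂weight α)
      atTop (𝓝 (∫ x, (divergence V x - 2 * α * q x) ∂weight α)) := by
    refine tendsto_integral_of_dominated_convergence (fun _ => M + 2 * K * Q) (fun N => ?_)
      (integrable_const _) (fun N => ?_) ?_
    · have h1 := Real.smoothTransition.continuous
      have h2 := continuous_layer
      exact Continuous.aestronglyMeasurable (by fun_prop)
    · filter_upwards [ae_mem_ball α] with x hx
      refine (norm_sub_le _ _).trans (add_le_add ?_ ?_)
      · rw [norm_mul, Complex.norm_real, Real.norm_of_nonneg (Real.smoothTransition.nonneg _)]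
        exact (mul_le_of_le_one_left (norm_nonneg _) (Real.smoothTransition.le_one _)).trans
          (hM x hx)
      · rw [norm_mul, norm_mul, Complex.norm_real, Complex.norm_ofNat]
        have := hK (N * (1 - ‖x‖ ^ 2))
        have := hQ x hx
        have := norm_nonneg (layer (N * (1 - ‖x‖ ^ 2)))
        gcongr
        linarith
    · filter_upwards [ae_mem_openBall α] with x hx
      refine tendsto_const_nhds.congr' ?_
      have h : 0 < 1 - ‖x‖ ^ 2 := by linarith [norm_sq_lt_one hx]
      have h2 : Tendsto (fun N : ℕ => (N : ℝ) * (1 - ‖x‖ ^ 2)) atTop atTop :=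
        tendsto_natCast_atTop_atTop.atTop_mul_const h
      filter_upwards [h2.eventually_gt_atTop 2] with N hN
      rw [Real.smoothTransition.one_of_one_le (by linarith), layer_eq_zero_of_gt hN]
      simp
  have hzero := fun N : ℕ => integral_cutPow_divergence α N hV hVq
  simp only [hzero] at hlim
  exact (tendsto_nhds_unique hlim tendsto_const_nhds)

end BallPSWF
namespace BallPSWF

open Filter Topology Set

/-! ### Rotation fields -/

/-- The infinitesimal rotation `x ↦ e_i × x`. -/
noncomputable def rotVec (i : Fin 3) : E3 →L[ℝ] E3 :=
  LinearMap.toContinuousLinearMap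
    ((WithLp.linearEquiv 2 ℝ (Fin 3 → ℝ)).symm.toLinearMap ∘ₗ
      crossProduct (Pi.single i 1) ∘ₗ (WithLp.linearEquiv 2 ℝ (Fin 3 → ℝ)).toLinearMap)

theorem rotVec_apply (i j : Fin 3) (x : E3) :
    rotVec i x j = ((Pi.single i 1 : Fin 3 → ℝ) ⨯₃ x.ofLp) j := rfl

/-- The `i`-th component of `(x × ∇) f`. -/
noncomputable def rotD (i : Fin 3) (f : E3 → ℂ) (x : E3) : ℂ := fderiv ℝ f x (rotVec i x)

theorem clm_eq_sum {F : Type*} [NormedAddCommGroup F] [NormedSpace ℝ F] (L : E3 →L[ℝ] F)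
    (v : E3) : L v = ∑ j, v j • L (EuclideanSpace.single j 1) := by
  conv_lhs => rw [← (EuclideanSpace.basisFun (Fin 3) ℝ).sum_repr v]
  simp

theorem fderiv_eq_sum (f : E3 → ℂ) (x v : E3) :
    fderiv ℝ f x v = ∑ j, (v j : ℂ) * partialD j f x := by
  simp only [clm_eq_sum (fderiv ℝ f x) v, partialD, Complex.real_smul]

theorem inner_rotVec (i : Fin 3) (x : E3) : inner ℝ x (rotVec i x) = 0 := by
  simp only [PiLp.inner_apply, Fin.sum_univ_three, rotVec_apply, cross_apply]
  fin_cases i <;> simp <;> ring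

theorem inner_rotVec_left (i : Fin 3) (x y : E3) :
    inner ℝ (rotVec i x) y = - inner ℝ x (rotVec i y) := by
  simp only [PiLp.inner_apply, Fin.sum_univ_three, rotVec_apply, cross_apply]
  fin_cases i <;> simp

/-- The ball is convex with nonempty interior, so derivatives within it are unique even at boundary
points. Hence any differentiable extension computes the one-sided gradient. -/
theorem crossGrad_apply {f g : E3 → ℂ} {x : E3} (hx : x ∈ ball) (h : ∀ y ∈ ball, f y = g y)
    (hg : DifferentiableAt ℝ g x) (i : Fin 3) : crossGrad f x i = rotD i g x := by
  have hu : UniqueDiffWithinAt ℝ ball x := by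
    refine uniqueDiffOn_convex (convex_closedBall _ _) ?_ x hx
    rw [interior_closedBall _ one_ne_zero]
    exact ⟨0, by simp⟩
  have hfd : fderivWithin ℝ f ball x = fderiv ℝ g x := by
    rw [fderivWithin_congr h (h x hx), hg.fderivWithin hu]
  rw [crossGrad, rotD, fderiv_eq_sum]
  simp only [gradBall, hfd, Fin.sum_univ_three, rotVec_apply, cross_apply]
  fin_cases i <;> simp [partialD] <;> ring

theorem contDiff_rotD (i : Fin 3) {f : E3 → ℂ} (hf : ContDiff ℝ ∞ f) : ContDiff ℝ ∞ (rotD i f) :=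
  (hf.fderiv_right (m := ∞) le_rfl).clm_apply (rotVec i).contDiff

theorem contDiff_partialD (i : Fin 3) {f : E3 → ℂ} (hf : ContDiff ℝ ∞ f) :
    ContDiff ℝ ∞ (partialD i f) :=
  (hf.fderiv_right (m := ∞) le_rfl).clm_apply contDiff_const

theorem partialD_mul (i : Fin 3) {f g : E3 → ℂ} {x : E3} (hf : DifferentiableAt ℝ f x)
    (hg : DifferentiableAt ℝ g x) :
    partialD i (fun y => f y * g y) x = f x * partialD i g x + g x * partialD i f x := by
  simp only [partialD, fderiv_fun_mul hf hg]
  simp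

theorem rotD_mul (i : Fin 3) {f g : E3 → ℂ} {x : E3} (hf : DifferentiableAt ℝ f x)
    (hg : DifferentiableAt ℝ g x) :
    rotD i (fun y => f y * g y) x = f x * rotD i g x + g x * rotD i f x := by
  simp only [rotD, fderiv_fun_mul hf hg]
  simp

theorem partialD_rotVec (i j : Fin 3) (x : E3) :
    partialD j (fun y => ((rotVec i y j : ℝ) : ℂ)) x = 0 := by
  have h : HasFDerivAt (fun y : E3 => ((rotVec i y j : ℝ) : ℂ))
      (Complex.ofRealCLM.comp ((EuclideanSpace.proj j).comp (rotVec i))) x :=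
    (Complex.ofRealCLM.comp ((EuclideanSpace.proj j).comp (rotVec i))).hasFDerivAt
  rw [partialD, h.fderiv]
  change ((rotVec i (EuclideanSpace.single j 1) j : ℝ) : ℂ) = 0
  rw [rotVec_apply, cross_apply]
  fin_cases i <;> fin_cases j <;> simp

/-- The field `f * rotVec i` is orthogonal to `x`, so the divergence theorem applies with `q = 0`;
and the `j`-th component of `e_i × y` does not involve `y j`, so only the derivative of `f` remains.
-/
theorem integral_rotD {α : ℝ} (hα : -1 < α) (i : Fin 3) {f : E3 → ℂ} (hf : ContDiff ℝ ∞ f) :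
    ∫ x, rotD i f x ∂weight α = 0 := by
  have hc : ∀ j, ContDiff ℝ ∞ fun y : E3 => ((rotVec i y j : ℝ) : ℂ) := fun j =>
    (Complex.ofRealCLM.comp ((EuclideanSpace.proj j).comp (rotVec i))).contDiff
  have h := integral_divergence_weight hα (V := fun y j => f y * (rotVec i y j : ℂ)) (q := 0)
    (fun j => (hf.mul (hc j)).of_le (by simp)) continuous_zero (fun x => by
      have h := inner_rotVec i x
      simp only [PiLp.inner_apply, Fin.sum_univ_three, RCLike.inner_apply, conj_trivial] at h
      have h' : (rotVec i x 0 * x 0 + rotVec i x 1 * x 1 + rotVec i x 2 * x 2 : ℂ) = 0 := by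
        exact_mod_cast h
      simp only [Fin.sum_univ_three, Pi.zero_apply, mul_zero]
      linear_combination f x * h')
  rw [← h]
  congr 1
  ext x
  simp only [divergence, Pi.zero_apply, mul_zero, sub_zero]
  rw [rotD, fderiv_eq_sum]
  refine Finset.sum_congr rfl fun j _ => ?_
  rw [partialD_mul j (hf.differentiable (by simp) x) ((hc j).differentiable (by simp) x),
    partialD_rotVec, mul_zero, zero_add]

theorem integral_rotD_mul {α : ℝ} (hα : -1 < α) (i : Fin 3) {f g : E3 → ℂ}
    (hf : ContDiff ℝ ∞ f) (hg : ContDiff ℝ ∞ g) :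
    ∫ x, rotD i f x * g x ∂weight α = - ∫ x, f x * rotD i g x ∂weight α := by
  have h := integral_rotD hα i (hf.mul hg)
  have e : ∀ x, rotD i (fun y => f y * g y) x = f x * rotD i g x + rotD i f x * g x := fun x => by
    rw [rotD_mul i (hf.differentiable (by simp) x) (hg.differentiable (by simp) x)]
    ring
  simp only [e] at h
  have h2 : ∫ x, (f x * rotD i g x + rotD i f x * g x) ∂weight α =
      ∫ x, f x * rotD i g x ∂weight α + ∫ x, rotD i f x * g x ∂weight α :=
    integral_add
      (integrable_of_continuous hα (hf.continuous.mul (contDiff_rotD i hg).continuous))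
      (integrable_of_continuous hα ((contDiff_rotD i hf).continuous.mul hg.continuous))
  rw [h2] at h
  linear_combination h

/-- The symmetric Hessian is contracted with an antisymmetric tensor; the first-order terms drop out
because `e_i × e_i = 0`. -/
theorem divergence_rotD {f : E3 → ℂ} (hf : ContDiff ℝ ∞ f) (x : E3) :
    divergence (fun y i => rotD i f y) x = 0 := by
  have hd : DifferentiableAt ℝ (fderiv ℝ f) x :=
    (hf.fderiv_right (m := ∞) le_rfl).differentiable (by simp) x
  have hs : IsSymmSndFDerivAt ℝ f x :=
    hf.contDiffAt.isSymmSndFDerivAt (by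
      rw [minSmoothness_of_isRCLikeNormedField]
      exact WithTop.coe_le_coe.2 le_top)
  have e : ∀ i, partialD i (fun y => rotD i f y) x =
      ∑ j, (rotVec i x j : ℂ) * fderiv ℝ (fderiv ℝ f) x (EuclideanSpace.single i 1)
        (EuclideanSpace.single j 1) := by
    intro i
    have h := hd.hasFDerivAt.clm_apply (rotVec i).hasFDerivAt
    have h' : fderiv ℝ (fun y => rotD i f y) x = _ := h.fderiv
    have h0 : rotVec i (EuclideanSpace.single i 1) = 0 := by
      ext j
      simp only [rotVec_apply, cross_apply]
      fin_cases i <;> fin_cases j <;> simp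
    rw [partialD, h']
    simp only [_root_.add_apply, ContinuousLinearMap.comp_apply, h0, map_zero,
      zero_add, ContinuousLinearMap.flip_apply]
    rw [clm_eq_sum]
    simp only [Complex.real_smul]
  simp only [divergence, e, Fin.sum_univ_three, rotVec_apply, cross_apply]
  rw [hs.eq (EuclideanSpace.single 1 1) (EuclideanSpace.single 0 1),
    hs.eq (EuclideanSpace.single 2 1) (EuclideanSpace.single 0 1),
    hs.eq (EuclideanSpace.single 2 1) (EuclideanSpace.single 1 1)]
  simp
  ring

/-! ### Rotation fields annihilate radial factors -/

theorem exists_norm_preserving_curve {x v : E3} (h : inner ℝ x v = 0) (hx : x ≠ 0) :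
    ∃ γ : ℝ → E3, γ 0 = x ∧ (∀ t, ‖γ t‖ = ‖x‖) ∧ HasDerivAt γ v 0 := by
  rcases eq_or_ne v 0 with rfl | hv
  · exact ⟨fun _ => x, rfl, fun _ => rfl, hasDerivAt_const _ _⟩
  have hx' : 0 < ‖x‖ := norm_pos_iff.2 hx
  have hv' : 0 < ‖v‖ := norm_pos_iff.2 hv
  obtain ⟨s, hs0, hs⟩ : ∃ s : ℝ, 0 < s ∧ ‖v‖ = s * ‖x‖ :=
    ⟨‖v‖ / ‖x‖, by positivity, by field_simp⟩
  -- The circle about the origin through `x` with velocity `v`; the angular speed is `s = ‖v‖ /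
  -- ‖x‖`.
  refine ⟨fun t => Real.cos (s * t) • x + (Real.sin (s * t) / s) • v, by simp, fun t => ?_, ?_⟩
  · have e : ‖Real.cos (s * t) • x + (Real.sin (s * t) / s) • v‖ ^ 2 = ‖x‖ ^ 2 := by
      rw [norm_add_sq_real, real_inner_smul_left, real_inner_smul_right, h, norm_smul, norm_smul,
        mul_pow, mul_pow, Real.norm_eq_abs, Real.norm_eq_abs, sq_abs, sq_abs, hs]
      have := Real.sin_sq_add_cos_sq (s * t)
      field_simp
      linear_combination s * ‖x‖ ^ 2 * this
    exact (pow_left_inj₀ (norm_nonneg _) (norm_nonneg _) two_ne_zero).1 e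
  · have h0 : HasDerivAt (fun t : ℝ => s * t) s 0 := by
      simpa using (hasDerivAt_id (0 : ℝ)).const_mul s
    have h1 := (h0.cos.smul_const x).add ((h0.sin.div_const s).smul_const v)
    refine h1.congr_deriv ?_
    simp [hs0.ne']

/-- A rotation field only sees the dependence on the position that remains when the norm is
frozen. -/
theorem rotD_eq_of_frozen {f : E3 → ℂ} {Φ : ℝ → E3 → ℂ} (hf : Differentiable ℝ f)
    (hΦ : ∀ r, Differentiable ℝ (Φ r)) (h : ∀ x ∈ ball, f x = Φ ‖x‖ x) (i : Fin 3) {x : E3}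
    (hx : x ∈ ball) : rotD i f x = rotD i (Φ ‖x‖) x := by
  rcases eq_or_ne x 0 with rfl | hx0
  · simp [rotD]
  obtain ⟨γ, h0, hn, hd⟩ := exists_norm_preserving_curve (inner_rotVec i x) hx0
  have hm : ∀ t, γ t ∈ ball := fun t => by simpa [ball, hn t] using hx
  have e : (fun t => f (γ t)) = fun t => Φ ‖x‖ (γ t) := by
    ext t
    rw [h _ (hm t), hn]
  have h1 : HasDerivAt (fun t => f (γ t)) (fderiv ℝ f x (rotVec i x)) 0 := by
    have := (hf (γ 0)).hasFDerivAt.comp_hasDerivAt 0 hd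
    rwa [h0] at this
  have h2 : HasDerivAt (fun t => Φ ‖x‖ (γ t)) (fderiv ℝ (Φ ‖x‖) x (rotVec i x)) 0 := by
    have := (hΦ ‖x‖ (γ 0)).hasFDerivAt.comp_hasDerivAt 0 hd
    rwa [h0] at this
  rw [e] at h1
  exact h1.unique h2

/-! ### Symmetry of the Sturm-Liouville operator -/

/-- The vector field `(I - x xᵗ) ∇ f`. -/
noncomputable def flux (f : E3 → ℂ) (x : E3) (i : Fin 3) : ℂ :=
  partialD i f x - (x i : ℂ) * ∑ j, (x j : ℂ) * partialD j f x

theorem contDiff_coord (i : Fin 3) : ContDiff ℝ ∞ fun x : E3 => ((x i : ℝ) : ℂ) :=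
  (Complex.ofRealCLM.comp (EuclideanSpace.proj i)).contDiff

theorem contDiff_euler {f : E3 → ℂ} (hf : ContDiff ℝ ∞ f) :
    ContDiff ℝ ∞ fun x : E3 => ∑ j, (x j : ℂ) * partialD j f x :=
  ContDiff.sum fun j _ => (contDiff_coord j).mul (contDiff_partialD j hf)

theorem contDiff_flux {f : E3 → ℂ} (hf : ContDiff ℝ ∞ f) (i : Fin 3) :
    ContDiff ℝ ∞ fun x => flux f x i :=
  (contDiff_partialD i hf).sub ((contDiff_coord i).mul (contDiff_euler hf))

theorem norm_sq_eq_sum (x : E3) : ((‖x‖ ^ 2 : ℝ) : ℂ) = ∑ i, (x i : ℂ) ^ 2 := by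
  rw [EuclideanSpace.real_norm_sq_eq]
  push_cast
  rfl

/-- The matrix `I - x xᵗ` degenerates in the normal direction on the sphere; this supplies the
factor required by `integral_divergence_weight`. -/
theorem sum_mul_flux (f : E3 → ℂ) (x : E3) :
    ∑ i, (x i : ℂ) * flux f x i =
      (1 - ‖x‖ ^ 2 : ℝ) * ∑ j, (x j : ℂ) * partialD j f x := by
  rw [Complex.ofReal_sub, norm_sq_eq_sum]
  simp only [flux, Fin.sum_univ_three]
  push_cast
  ring

theorem divergence_mul {f : E3 → ℂ} {V : E3 → Fin 3 → ℂ} {x : E3} (hf : DifferentiableAt ℝ f x)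
    (hV : ∀ i, DifferentiableAt ℝ (fun y => V y i) x) :
    divergence (fun y i => f y * V y i) x =
      f x * divergence V x + ∑ i, partialD i f x * V x i := by
  simp only [divergence, Finset.mul_sum, ← Finset.sum_add_distrib]
  refine Finset.sum_congr rfl fun i _ => ?_
  rw [partialD_mul i hf (hV i)]
  ring

theorem divergence_sub {V W : E3 → Fin 3 → ℂ} {x : E3}
    (hV : ∀ i, DifferentiableAt ℝ (fun y => V y i) x)
    (hW : ∀ i, DifferentiableAt ℝ (fun y => W y i) x) :
    divergence (fun y i => V y i - W y i) x = divergence V x - divergence W x := by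
  simp only [divergence, ← Finset.sum_sub_distrib]
  refine Finset.sum_congr rfl fun i _ => ?_
  simp only [partialD, fderiv_fun_sub (hV i) (hW i)]
  simp

/-- Differentiating the weight produces `(1 - ‖x‖²) ^ (α - 1)`, but only against the radial part of
the flux, whose factor `1 - ‖x‖²` restores the power `α`. All powers then cancel, leaving smooth
coefficients. -/
theorem sturmLiouville_eq (α c : ℝ) {f : E3 → ℂ} (hf : ContDiff ℝ ∞ f) {x : E3}
    (hx : x ∈ Metric.ball (0 : E3) 1) :
    sturmLiouville α c f x =
      -(divergence (flux f) x - 2 * α * ∑ j, (x j : ℂ) * partialD j f x) +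
        ((c ^ 2 * ‖x‖ ^ 2 : ℝ) : ℂ) * f x := by
  have ht : 0 < 1 - ‖x‖ ^ 2 := by linarith [norm_sq_lt_one hx]
  have hd : HasDerivAt (fun s : ℝ => s ^ α) (α * (1 - ‖x‖ ^ 2) ^ (α - 1)) (1 - ‖x‖ ^ 2) :=
    Real.hasDerivAt_rpow_const (Or.inl ht.ne')
  have hw : DifferentiableAt ℝ (fun y : E3 => (((1 - ‖y‖ ^ 2) ^ α : ℝ) : ℂ)) x := by
    have h1 : DifferentiableAt ℝ (fun y : E3 => 1 - ‖y‖ ^ 2) x :=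
      ((contDiff_norm_sq ℝ (n := 1)).differentiable (by simp) x).const_sub 1
    exact Complex.ofRealCLM.differentiableAt.comp x (h1.rpow_const (Or.inl ht.ne'))
  have e := divergence_mul hw fun i => (contDiff_flux hf i).differentiable (by simp) x
  have e1 : ∀ i, partialD i (fun y : E3 => (((1 - ‖y‖ ^ 2) ^ α : ℝ) : ℂ)) x * flux f x i =
      (-2 * (α * (1 - ‖x‖ ^ 2) ^ (α - 1)) : ℝ) * ((x i : ℂ) * flux f x i) := by
    intro i
    rw [partialD, fderiv_norm_sq_single x _ hd.differentiableAt, hd.deriv]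
    push_cast
    ring
  rw [Finset.sum_congr rfl fun i _ => e1 i, ← Finset.mul_sum, sum_mul_flux] at e
  rw [sturmLiouville]
  change -_ * divergence (fun y i => (((1 - ‖y‖ ^ 2) ^ α : ℝ) : ℂ) * flux f y i) x + _ = _
  rw [e]
  have h1 : (((1 - ‖x‖ ^ 2) ^ (-α) : ℝ) : ℂ) * ((1 - ‖x‖ ^ 2) ^ α : ℝ) = 1 := by
    rw [← Complex.ofReal_mul, ← Real.rpow_add ht]
    simp
  have h2 : (1 - ‖x‖ ^ 2) ^ (α - 1) * (1 - ‖x‖ ^ 2) = (1 - ‖x‖ ^ 2) ^ α := by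
    rw [Real.rpow_sub_one ht.ne']
    field_simp
  have h3 : (((1 - ‖x‖ ^ 2) ^ (α - 1) : ℝ) : ℂ) * (1 - ‖x‖ ^ 2 : ℝ) = ((1 - ‖x‖ ^ 2) ^ α : ℝ) := by
    rw [← Complex.ofReal_mul, h2]
  rw [Complex.ofReal_mul (-2), Complex.ofReal_mul α]
  set E := ∑ j, (x j : ℂ) * partialD j f x
  push_cast at h1 h3 ⊢
  linear_combination (-divergence (flux f) x + 2 * α * E) * h1 +
    2 * α * E * (((1 - ‖x‖ ^ 2) ^ (-α) : ℝ) : ℂ) * h3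

/-- Green's identity for `f * flux g - g * flux f`: the products of first derivatives cancel because
`I - x xᵗ` is symmetric. -/
theorem integral_sturmLiouville_symm {α : ℝ} (hα : -1 < α) (c : ℝ) {f g : E3 → ℂ}
    (hf : ContDiff ℝ ∞ f) (hg : ContDiff ℝ ∞ g) :
    ∫ x, (sturmLiouville α c f x * g x - f x * sturmLiouville α c g x) ∂weight α = 0 := by
  have h := integral_divergence_weight hα (V := fun y i => f y * flux g y i - g y * flux f y i)
    (q := fun y => f y * (∑ j, (y j : ℂ) * partialD j g y) -
      g y * ∑ j, (y j : ℂ) * partialD j f y)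
    (fun i => ((hf.mul (contDiff_flux hg i)).sub (hg.mul (contDiff_flux hf i))).of_le (by simp))
    ((hf.mul (contDiff_euler hg)).sub (hg.mul (contDiff_euler hf))).continuous
    (fun x => by
      have e1 := sum_mul_flux f x
      have e2 := sum_mul_flux g x
      set Ef := ∑ j, (x j : ℂ) * partialD j f x
      set Eg := ∑ j, (x j : ℂ) * partialD j g x
      rw [mul_sub]
      have : ∀ i, (x i : ℂ) * (f x * flux g x i - g x * flux f x i) =
        f x * ((x i : ℂ) * flux g x i) - g x * ((x i : ℂ) * flux f x i) := fun i => by ring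
      simp only [this, Finset.sum_sub_distrib, ← Finset.mul_sum, e1, e2]
      ring)
  rw [← h]
  refine integral_congr_ae ?_
  filter_upwards [ae_mem_openBall α] with x hx
  have d1 := fun i => (contDiff_flux hf i).differentiable (by simp) x
  have d2 := fun i => (contDiff_flux hg i).differentiable (by simp) x
  have d3 := hf.differentiable (by simp) x
  have d4 := hg.differentiable (by simp) x
  rw [sturmLiouville_eq α c hf hx, sturmLiouville_eq α c hg hx,
    divergence_sub (V := fun y i => f y * flux g y i) (W := fun y i => g y * flux f y i)
      (fun i => d3.mul (d2 i)) (fun i => d4.mul (d1 i)), divergence_mul d3 d2, divergence_mul d4 d1]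
  have e : ∑ i, partialD i f x * flux g x i = ∑ i, partialD i g x * flux f x i := by
    simp only [flux, Fin.sum_univ_three]
    ring
  rw [e]
  ring

theorem sturmLiouville_congr (α c : ℝ) {f g : E3 → ℂ} (h : ∀ x ∈ ball, f x = g x) {x : E3}
    (hx : x ∈ Metric.ball (0 : E3) 1) : sturmLiouville α c f x = sturmLiouville α c g x := by
  have hp : ∀ i, ∀ y ∈ Metric.ball (0 : E3) 1, partialD i f y = partialD i g y := by
    intro i y hy
    have : f =ᶠ[𝓝 y] g := by
      filter_upwards [Metric.isOpen_ball.mem_nhds hy] with z hz using h z (openBall_subset hz)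
    rw [partialD, partialD, this.fderiv_eq]
  have hd : ∀ V W : E3 → Fin 3 → ℂ, (∀ y ∈ Metric.ball (0 : E3) 1, V y = W y) →
      divergence V x = divergence W x := by
    intro V W hVW
    refine Finset.sum_congr rfl fun i _ => ?_
    have : (fun y => V y i) =ᶠ[𝓝 x] fun y => W y i := by
      filter_upwards [Metric.isOpen_ball.mem_nhds hx] with z hz using by rw [hVW z hz]
    rw [partialD, partialD, this.fderiv_eq]
  rw [sturmLiouville, sturmLiouville, h x (openBall_subset hx)]
  congr 2
  refine hd _ _ fun y hy => ?_
  ext i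
  simp only [hp _ y hy]

open ComplexConjugate in
theorem sturmLiouville_conj (α c : ℝ) (f : E3 → ℂ) (x : E3) :
    sturmLiouville α c (fun y => conj (f y)) x = conj (sturmLiouville α c f x) := by
  have hp : ∀ (i : Fin 3) (g : E3 → ℂ) (y : E3),
      partialD i (fun z => conj (g z)) y = conj (partialD i g y) := by
    intro i g y
    have := Complex.conjCLE.comp_fderiv (f := g) (x := y)
    rw [partialD, partialD]
    have h2 : (fun z => conj (g z)) = Complex.conjCLE ∘ g := by ext; simp
    rw [h2, this]
    simp
  have hs : ∀ y (i : Fin 3), (((1 - ‖y‖ ^ 2) ^ α : ℝ) : ℂ) * (conj (partialD i f y) -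
      (y i : ℂ) * ∑ j : Fin 3, (y j : ℂ) * conj (partialD j f y)) =
      conj ((((1 - ‖y‖ ^ 2) ^ α : ℝ) : ℂ) * (partialD i f y -
      (y i : ℂ) * ∑ j : Fin 3, (y j : ℂ) * partialD j f y)) := by
    intro y i
    simp only [map_mul, map_sub, map_sum, Complex.conj_ofReal]
  rw [sturmLiouville, divergence]
  simp only [hp, hs]
  rw [sturmLiouville, divergence]
  simp only [map_add, map_mul, map_neg, map_sum, Complex.conj_ofReal]

end BallPSWF
namespace BallPSWF

open Filter Topology Set

/-! ### The Jacobi differential equation -/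

section Jacobi

open Polynomial

/-- The classical Jacobi polynomial `P_k^{(m,m)}` as a polynomial. -/
noncomputable def jacobiPoly (k m : ℕ) : ℝ[X] :=
  ∑ s ∈ Finset.range (k + 1), C (((k + m).choose (k - s) : ℝ) * ((k + m).choose s : ℝ)) *
    ((C (1 / 2) * (X - 1)) ^ s * (C (1 / 2) * (X + 1)) ^ (k - s))

theorem eval_jacobiPoly (k m : ℕ) (η : ℝ) : (jacobiPoly k m).eval η = classicalJacobi k m η := by
  simp only [jacobiPoly, classicalJacobi, eval_finsetSum, eval_mul, eval_C, eval_pow, eval_sub,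
    eval_add, eval_X, eval_one]
  refine Finset.sum_congr rfl fun s _ => ?_
  rw [show (1 / 2 : ℝ) * (η - 1) = (η - 1) / 2 by ring,
    show (1 / 2 : ℝ) * (η + 1) = (η + 1) / 2 by ring]
  ring

/-- This relation between consecutive coefficients is what makes the sums in `jacobiPoly_ode` cancel
after an index shift. -/
theorem jacobi_coeff_recurrence {k s : ℕ} (m : ℕ) (hs : s < k) :
    (((k - s : ℕ) : ℝ) * ((k - s : ℕ) + m)) *
        (((k + m).choose (k - s) : ℝ) * ((k + m).choose s : ℝ)) =
      (((s + 1 : ℕ) : ℝ) * ((s + 1 : ℕ) + m)) *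
        (((k + m).choose (k - (s + 1)) : ℝ) * ((k + m).choose (s + 1) : ℝ)) := by
  obtain ⟨j, rfl⟩ : ∃ j, k = s + j + 1 := ⟨k - s - 1, by omega⟩
  have e1 : s + j + 1 - s = j + 1 := by omega
  have e2 : s + j + 1 - (s + 1) = j := by omega
  have h1 := Nat.choose_succ_right_eq (s + j + 1 + m) s
  have h2 := Nat.choose_succ_right_eq (s + j + 1 + m) j
  rw [show s + j + 1 + m - s = j + 1 + m by omega] at h1
  rw [show s + j + 1 + m - j = s + 1 + m by omega] at h2
  rw [e1, e2]
  have h1' : ((s + j + 1 + m).choose (s + 1) : ℝ) * (s + 1) =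
    (s + j + 1 + m).choose s * (j + 1 + m) := by exact_mod_cast h1
  have h2' : ((s + j + 1 + m).choose (j + 1) : ℝ) * (j + 1) =
    (s + j + 1 + m).choose j * (s + 1 + m) := by exact_mod_cast h2
  push_cast
  linear_combination ((j : ℝ) + 1 + m) * ((s + j + 1 + m).choose s : ℝ) * h2' -
    ((s : ℝ) + 1 + m) * ((s + j + 1 + m).choose j : ℝ) * h1'

theorem derivative_half_pow (a : ℝ[X]) (ha : derivative a = 1) (s : ℕ) :
    derivative ((C (1 / 2) * a) ^ s) =
      C (1 / 2) * ((s : ℝ[X]) * (C (1 / 2) * a) ^ (s - 1)) := by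
  simp only [derivative_pow, derivative_mul, derivative_C, ha, map_natCast]
  ring

theorem natCast_mul_pow_pred (u : ℝ[X]) (s : ℕ) : u * ((s : ℝ[X]) * u ^ (s - 1)) = s * u ^ s := by
  rcases s with _ | s
  · simp
  · simp only [Nat.add_sub_cancel]
    ring

/-- In these variables `X = u + v`, `1 - X² = -4uv`, and both derivatives are `1/2`, so the operator
sends a monomial to itself and its two neighbours of equal total degree. The truncated exponents are
harmless: each comes with a factor that vanishes when truncation occurs. -/
theorem jacobi_operator_monomial (m s j : ℕ) :
    let u : ℝ[X] := C (1 / 2) * (X - 1)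
    let v : ℝ[X] := C (1 / 2) * (X + 1)
    (1 - X ^ 2) * derivative (derivative (u ^ s * v ^ j)) -
        (2 * (m : ℝ[X]) + 2) * X * derivative (u ^ s * v ^ j) =
      -(((s : ℝ[X]) + (m : ℝ[X])) * (s : ℝ[X]) * (u ^ (s - 1) * v ^ (j + 1))) - ((j : ℝ[X]) + (m : ℝ[X])) * (j : ℝ[X]) * (u ^ (s + 1) * v ^ (j - 1)) -
        (2 * (s : ℝ[X]) * (j : ℝ[X]) + ((m : ℝ[X]) + 1) * ((s : ℝ[X]) + (j : ℝ[X]))) * (u ^ s * v ^ j) := by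
  intro u v
  have hu : ∀ s : ℕ, derivative (u ^ s) = C (1 / 2) * ((s : ℝ[X]) * u ^ (s - 1)) := fun s =>
    derivative_half_pow (X - 1) (by simp) s
  have hv : ∀ s : ℕ, derivative (v ^ s) = C (1 / 2) * ((s : ℝ[X]) * v ^ (s - 1)) := fun s =>
    derivative_half_pow (X + 1) (by simp) s
  have d1 : derivative (u ^ s * v ^ j) = C (1 / 2) * (((s : ℝ[X]) * u ^ (s - 1)) * v ^ j +
      u ^ s * ((j : ℝ[X]) * v ^ (j - 1))) := by
    rw [derivative_mul, hu, hv]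
    ring
  have d2 : derivative (derivative (u ^ s * v ^ j)) = C (1 / 2) * C (1 / 2) *
      ((s : ℝ[X]) * (((s - 1 : ℕ) : ℝ[X]) * u ^ (s - 1 - 1)) * v ^ j +
      2 * (((s : ℝ[X]) * u ^ (s - 1)) * ((j : ℝ[X]) * v ^ (j - 1))) +
      u ^ s * ((j : ℝ[X]) * (((j - 1 : ℕ) : ℝ[X]) * v ^ (j - 1 - 1)))) := by
    rw [d1]
    simp only [derivative_mul, derivative_add, derivative_C, derivative_natCast, hu, hv]
    ring
  have hh : C (1 / 2 : ℝ) + C (1 / 2) = (1 : ℝ[X]) := by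
    rw [← C_add]
    norm_num
  have hX : (X : ℝ[X]) = u + v := by
    simp only [u, v]
    linear_combination -X * hh
  have hh2 : C (1 / 2 : ℝ) * 2 = (1 : ℝ[X]) := by linear_combination hh
  have h1X : (1 - X ^ 2 : ℝ[X]) = -(4 * u * v) := by
    simp only [u, v]
    linear_combination (X ^ 2 - 1) * (C (1 / 2) * 2 + 1) * hh2
  have key : ∀ (w : ℝ[X]) (t : ℕ), w * ((t : ℝ[X]) * (((t - 1 : ℕ) : ℝ[X]) * w ^ (t - 1 - 1))) =
      (t - 1) * (t * w ^ (t - 1)) := by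
    intro w t
    rcases t with _ | t
    · simp
    · have := natCast_mul_pow_pred w t
      simp only [Nat.add_sub_cancel, Nat.cast_add, Nat.cast_one]
      linear_combination ((t : ℝ[X]) + 1) * this
  have ku := key u s
  have kv := key v j
  have pu := natCast_mul_pow_pred u s
  have pv := natCast_mul_pow_pred v j
  have c4 : 4 * (C (1 / 2 : ℝ) * C (1 / 2)) = (1 : ℝ[X]) := by
    linear_combination (C (1 / 2) * 2 + 1) * hh2
  rw [d2, h1X, d1, hX, pow_succ, pow_succ]
  set A1 := (s : ℝ[X]) * u ^ (s - 1)
  set B1 := (j : ℝ[X]) * v ^ (j - 1)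
  set A2 := (s : ℝ[X]) * (((s - 1 : ℕ) : ℝ[X]) * u ^ (s - 1 - 1))
  set B2 := (j : ℝ[X]) * (((j - 1 : ℕ) : ℝ[X]) * v ^ (j - 1 - 1))
  have t1 : -(4 * u * v) * (C (1 / 2 : ℝ) * C (1 / 2) * (A2 * v ^ j + 2 * (A1 * B1) + u ^ s * B2)) =
      -(((s : ℝ[X]) - 1) * A1 * (v ^ j * v) + 2 * ((s : ℝ[X]) * u ^ s) * ((j : ℝ[X]) * v ^ j) +
        ((j : ℝ[X]) - 1) * B1 * (u ^ s * u)) := by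
    linear_combination (-(u * v) * (A2 * v ^ j + 2 * (A1 * B1) + u ^ s * B2)) * c4 -
      v * v ^ j * ku - u * u ^ s * kv - 2 * (v * B1) * pu - 2 * (s * u ^ s) * pv
  have t2 : (2 * (m : ℝ[X]) + 2) * (u + v) * (C (1 / 2 : ℝ) * (A1 * v ^ j + u ^ s * B1)) =
      ((m : ℝ[X]) + 1) * ((s + j) * (u ^ s * v ^ j) + A1 * (v ^ j * v) + B1 * (u ^ s * u)) := by
    linear_combination ((m + 1) * (u + v) * (A1 * v ^ j + u ^ s * B1)) * hh2 +
      (m + 1) * v ^ j * pu + (m + 1) * u ^ s * pv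
  rw [t1, t2]
  simp only [A1, B1]
  ring

theorem jacobiPoly_ode (k m : ℕ) :
    (1 - X ^ 2) * derivative (derivative (jacobiPoly k m)) -
      (2 * (m : ℝ[X]) + 2) * X * derivative (jacobiPoly k m) +
      ((k : ℝ[X]) * ((k : ℝ[X]) + 2 * (m : ℝ[X]) + 1)) * jacobiPoly k m = 0 := by
  set u : ℝ[X] := C (1 / 2) * (X - 1) with hu
  set v : ℝ[X] := C (1 / 2) * (X + 1) with hv
  set a : ℕ → ℝ[X] := fun s => C (((k + m).choose (k - s) : ℝ) * ((k + m).choose s : ℝ)) with ha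
  have hrec : ∀ s, s < k → (((k - s : ℕ) : ℝ[X]) * ((k - s : ℕ) + m)) * a s =
      (((s + 1 : ℕ) : ℝ[X]) * ((s + 1 : ℕ) + m)) * a (s + 1) := by
    intro s hs
    have := congrArg (C : ℝ → ℝ[X]) (jacobi_coeff_recurrence m hs)
    simpa only [ha, C_mul, C_add, map_natCast] using this
  have h1 : ∑ s ∈ Finset.range (k + 1), (((k - s : ℕ) : ℝ[X]) * ((k - s : ℕ) + m)) * a s *
        (u ^ s * v ^ (k - s)) =
      ∑ s ∈ Finset.range (k + 1), ((s : ℝ[X]) * (s + m)) * a s *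
        (u ^ (s - 1) * v ^ (k - s + 1)) := by
    rw [Finset.sum_range_succ, Finset.sum_range_succ']
    simp only [Nat.sub_self, Nat.cast_zero, zero_mul, add_zero]
    refine Finset.sum_congr rfl fun s hs => ?_
    rw [hrec s (Finset.mem_range.1 hs), Nat.add_sub_cancel,
      show k - (s + 1) + 1 = k - s by have := Finset.mem_range.1 hs; omega]
  have h2 : ∑ s ∈ Finset.range (k + 1), (((k - s : ℕ) : ℝ[X]) * ((k - s : ℕ) + m)) * a s *
        (u ^ (s + 1) * v ^ (k - s - 1)) =
      ∑ s ∈ Finset.range (k + 1), ((s : ℝ[X]) * (s + m)) * a s * (u ^ s * v ^ (k - s)) := by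
    rw [Finset.sum_range_succ, Finset.sum_range_succ']
    simp only [Nat.sub_self, Nat.cast_zero, zero_mul, add_zero]
    refine Finset.sum_congr rfl fun s hs => ?_
    rw [hrec s (Finset.mem_range.1 hs),
      show k - (s + 1) = k - s - 1 by omega]
  have hP : jacobiPoly k m = ∑ s ∈ Finset.range (k + 1), a s * (u ^ s * v ^ (k - s)) := rfl
  have hD : ∀ q : ℕ → ℝ[X], derivative (∑ s ∈ Finset.range (k + 1), a s * q s) =
      ∑ s ∈ Finset.range (k + 1), a s * derivative (q s) := by
    intro q
    rw [derivative_sum]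
    refine Finset.sum_congr rfl fun s _ => ?_
    rw [ha, derivative_C_mul]
  rw [hP, hD, hD, Finset.mul_sum, Finset.mul_sum, Finset.mul_sum, ← Finset.sum_sub_distrib,
    ← Finset.sum_add_distrib]
  -- With `j = k - s`, subtracting the diagonal coefficient `2sj + (m+1)k` from `k(k+2m+1)` leaves
  -- `j(j+m) + s(s+m)`. The two summands cancel the two neighbour terms through `h1` and `h2`.
  have hterm : ∀ s ∈ Finset.range (k + 1),
      (1 - X ^ 2) * (a s * derivative (derivative (u ^ s * v ^ (k - s)))) -
        (2 * (m : ℝ[X]) + 2) * X * (a s * derivative (u ^ s * v ^ (k - s))) +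
        ((k : ℝ[X]) * ((k : ℝ[X]) + 2 * (m : ℝ[X]) + 1)) * (a s * (u ^ s * v ^ (k - s))) =
      ((((k - s : ℕ) : ℝ[X]) * (((k - s : ℕ) : ℝ[X]) + (m : ℝ[X]))) * a s * (u ^ s * v ^ (k - s)) -
        ((s : ℝ[X]) * ((s : ℝ[X]) + (m : ℝ[X]))) * a s * (u ^ (s - 1) * v ^ (k - s + 1))) -
      ((((k - s : ℕ) : ℝ[X]) * (((k - s : ℕ) : ℝ[X]) + (m : ℝ[X]))) * a s * (u ^ (s + 1) * v ^ (k - s - 1)) -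
        ((s : ℝ[X]) * ((s : ℝ[X]) + (m : ℝ[X]))) * a s * (u ^ s * v ^ (k - s))) := by
    intro s hs
    have h := jacobi_operator_monomial m s (k - s)
    simp only [← hu, ← hv] at h
    have hk : (k : ℝ[X]) = s + (k - s : ℕ) := by
      rw [← Nat.cast_add]
      congr 1
      have := Finset.mem_range.1 hs
      omega
    rw [hk]
    linear_combination a s * h
  rw [Finset.sum_congr rfl hterm, Finset.sum_sub_distrib, Finset.sum_sub_distrib,
    Finset.sum_sub_distrib, h1, h2]
  ring

theorem classicalJacobi_neg (k m : ℕ) (η : ℝ) :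
    classicalJacobi k m (-η) = (-1) ^ k * classicalJacobi k m η := by
  rw [classicalJacobi, classicalJacobi, ← Finset.sum_range_reflect, Finset.mul_sum]
  refine Finset.sum_congr rfl fun s hs => ?_
  have hs' : s ≤ k := Nat.lt_succ_iff.1 (Finset.mem_range.1 hs)
  rw [show k + 1 - 1 - s = k - s by omega, show k - (k - s) = s by omega,
    show (-η - 1) / 2 = -1 * ((η + 1) / 2) by ring, show (-η + 1) / 2 = -1 * ((η - 1) / 2) by ring,
    mul_pow, mul_pow]
  have : (-1 : ℝ) ^ k = (-1) ^ (k - s) * (-1) ^ s := by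
    rw [← pow_add]
    congr 1
    omega
  rw [this]
  ring

end Jacobi

/-! ### Rotation fields on functions of the form `p(x₃) h(x₁ + i x₂)` -/

/-- The complex coordinate `x₁ + i x₂`. -/
noncomputable def planar (x : E3) : ℂ := (x 0 : ℂ) + Complex.I * (x 1 : ℂ)

theorem differentiable_coord (j : Fin 3) : Differentiable ℝ fun y : E3 => ((y j : ℝ) : ℂ) :=
  (contDiff_coord j).differentiable (by simp)

theorem rotD_coord (i j : Fin 3) (x : E3) : rotD i (fun y => (y j : ℂ)) x = rotVec i x j := by
  have h : HasFDerivAt (fun y : E3 => ((y j : ℝ) : ℂ))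
      (Complex.ofRealCLM.comp (EuclideanSpace.proj j)) x :=
    (Complex.ofRealCLM.comp (EuclideanSpace.proj j)).hasFDerivAt
  rw [rotD, h.fderiv]
  simp

theorem hasFDerivAt_axial {p : ℝ → ℂ} {h : ℂ → ℂ} {p' h' : ℂ} {x : E3}
    (hp : HasDerivAt p p' (x 2)) (hh : HasDerivAt h h' (planar x)) :
    ∃ L : E3 →L[ℝ] ℂ, HasFDerivAt (fun y : E3 => p (y 2) * h (planar y)) L x ∧
      ∀ v, L v = v 2 * p' * h (planar x) + p (x 2) * h' * planar v := by
  have h2 : HasFDerivAt (fun y : E3 => y 2) (EuclideanSpace.proj (𝕜 := ℝ) (2 : Fin 3)) x :=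
    (EuclideanSpace.proj (𝕜 := ℝ) (2 : Fin 3)).hasFDerivAt
  let W : E3 →L[ℝ] ℂ := Complex.ofRealCLM.comp (EuclideanSpace.proj 0) +
    Complex.I • Complex.ofRealCLM.comp (EuclideanSpace.proj 1)
  have hW : HasFDerivAt planar W x := W.hasFDerivAt
  have hpc := hp.hasFDerivAt.comp x h2
  have hhc := (hh.hasFDerivAt.restrictScalars ℝ).comp x hW
  refine ⟨_, hpc.mul hhc, fun v => ?_⟩
  simp [W, planar]
  ring

section Axial

variable {p p1 p2 : ℝ → ℂ} {h h1 h2 : ℂ → ℂ}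

theorem differentiable_axial (hp : ∀ t, HasDerivAt p (p1 t) t)
    (hh : ∀ w, HasDerivAt h (h1 w) w) :
    Differentiable ℝ fun y : E3 => p (y 2) * h (planar y) := fun x => by
  obtain ⟨L, hL, -⟩ := hasFDerivAt_axial (hp (x 2)) (hh (planar x))
  exact hL.differentiableAt

theorem rotD_axial (hp : ∀ t, HasDerivAt p (p1 t) t) (hh : ∀ w, HasDerivAt h (h1 w) w)
    (i : Fin 3) (x : E3) :
    rotD i (fun y => p (y 2) * h (planar y)) x =
      rotVec i x 2 * (p1 (x 2) * h (planar x)) +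
        planar (rotVec i x) * (p (x 2) * h1 (planar x)) := by
  obtain ⟨L, hL, hv⟩ := hasFDerivAt_axial (hp (x 2)) (hh (planar x))
  rw [rotD, hL.fderiv, hv]
  ring

theorem rotVec_values (x : E3) :
    rotVec 0 x 0 = 0 ∧ rotVec 0 x 1 = -x 2 ∧ rotVec 0 x 2 = x 1 ∧
    rotVec 1 x 0 = x 2 ∧ rotVec 1 x 1 = 0 ∧ rotVec 1 x 2 = -x 0 ∧
    rotVec 2 x 0 = -x 1 ∧ rotVec 2 x 1 = x 0 ∧ rotVec 2 x 2 = 0 := by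
  simp only [rotVec_apply, cross_apply]
  simp

theorem planar_rotVec (x : E3) :
    planar (rotVec 0 x) = -(Complex.I * x 2) ∧ planar (rotVec 1 x) = x 2 ∧
    planar (rotVec 2 x) = Complex.I * planar x := by
  obtain ⟨h1, h2, h3, h4, h5, h6, h7, h8, h9⟩ := rotVec_values x
  simp only [planar, h1, h2, h4, h5, h7, h8]
  refine ⟨by push_cast; ring, by simp, ?_⟩
  push_cast
  linear_combination (-(x 1 : ℂ)) * Complex.I_sq

theorem rotD_two_axial (hp : ∀ t, HasDerivAt p (p1 t) t) (hh : ∀ w, HasDerivAt h (h1 w) w) {m : ℂ}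
    (hm : ∀ w, w * h1 w = m * h w) (x : E3) :
    rotD 2 (fun y => p (y 2) * h (planar y)) x =
      Complex.I * m * (p (x 2) * h (planar x)) := by
  rw [rotD_axial hp hh, (planar_rotVec x).2.2, (rotVec_values x).2.2.2.2.2.2.2.2]
  rw [Complex.ofReal_zero]
  linear_combination Complex.I * p (x 2) * hm (planar x)

/-- The hypothesis `hm` is Euler's relation for `h` of degree `m`. With it the spherical Laplacian
becomes an ordinary differential operator on `p`, which is the Jacobi operator once `x₁² + x₂²` is
written as `r² - x₃²`. -/
theorem casimir_axial (hp : ∀ t, HasDerivAt p (p1 t) t) (hp1 : ∀ t, HasDerivAt p1 (p2 t) t)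
    (hh : ∀ w, HasDerivAt h (h1 w) w) (hh1 : ∀ w, HasDerivAt h1 (h2 w) w) {m : ℂ}
    (hm : ∀ w, w * h1 w = m * h w) (x : E3) :
    ∑ i, rotD i (rotD i fun y => p (y 2) * h (planar y)) x =
      (((x 0 : ℂ) ^ 2 + (x 1 : ℂ) ^ 2) * p2 (x 2) - (2 * m + 2) * x 2 * p1 (x 2) -
        m * (m + 1) * p (x 2)) * h (planar x) := by
  have dA := differentiable_axial hp1 hh
  have dB := differentiable_axial hp hh1
  have dF := differentiable_axial hp hh
  have e0 : (rotD 0 fun y => p (y 2) * h (planar y)) = fun y : E3 =>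
      (y 1 : ℂ) * (p1 (y 2) * h (planar y)) + (-(Complex.I)) * ((y 2 : ℂ) *
        (p (y 2) * h1 (planar y))) := by
    ext y
    rw [rotD_axial hp hh, (planar_rotVec y).1, (rotVec_values y).2.2.1]
    ring
  have e1 : (rotD 1 fun y => p (y 2) * h (planar y)) = fun y : E3 =>
      (-1) * ((y 0 : ℂ) * (p1 (y 2) * h (planar y))) + (y 2 : ℂ) *
        (p (y 2) * h1 (planar y)) := by
    ext y
    rw [rotD_axial hp hh, (planar_rotVec y).2.1, (rotVec_values y).2.2.2.2.2.1]
    push_cast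
    ring
  have e2 : (rotD 2 fun y => p (y 2) * h (planar y)) = fun y : E3 =>
      (Complex.I * m) * (p (y 2) * h (planar y)) := by
    ext y
    exact rotD_two_axial hp hh hm y
  have radd : ∀ (i : Fin 3) (f g : E3 → ℂ), Differentiable ℝ f → Differentiable ℝ g →
      rotD i (fun y => f y + g y) x = rotD i f x + rotD i g x := by
    intro i f g hf hg
    simp [rotD, fderiv_fun_add (hf x) (hg x)]
  have rcm : ∀ (i : Fin 3) (z : ℂ) (f : E3 → ℂ), Differentiable ℝ f →
      rotD i (fun y => z * f y) x = z * rotD i f x := by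
    intro i z f hf
    simp [rotD, fderiv_const_mul (hf x)]
  have c0 := differentiable_coord 0
  have c1 := differentiable_coord 1
  have c2 := differentiable_coord 2
  obtain ⟨-, q2, q3, q4, -, q6, -⟩ := rotVec_values x
  obtain ⟨w1, w2, -⟩ := planar_rotVec x
  have d1 : Differentiable ℝ fun y : E3 => (y 1 : ℂ) * (p1 (y 2) * h (planar y)) := c1.mul dA
  have d0 : Differentiable ℝ fun y : E3 => (y 0 : ℂ) * (p1 (y 2) * h (planar y)) := c0.mul dA
  have d2 : Differentiable ℝ fun y : E3 => (y 2 : ℂ) * (p (y 2) * h1 (planar y)) := c2.mul dB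
  rw [Fin.sum_univ_three, e0, e1, e2, radd 0 _ _ d1 (d2.const_mul _),
    radd 1 _ _ (d0.const_mul _) d2, rcm 0 _ _ d2, rcm 1 _ _ d0, rcm 2 _ _ dF, rotD_mul 0 (c1 x) (dA x), rotD_mul 0 (c2 x) (dB x),
    rotD_mul 1 (c0 x) (dA x), rotD_mul 1 (c2 x) (dB x), rotD_two_axial hp hh hm,
    rotD_axial hp1 hh, rotD_axial hp1 hh, rotD_axial hp hh1, rotD_axial hp hh1]
  simp only [rotD_coord, q2, q3, q4, q6, w1, w2]
  have hw := hm (planar x)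
  simp only [planar] at *
  set H := h ((x 0 : ℂ) + Complex.I * (x 1 : ℂ))
  set H1 := h1 ((x 0 : ℂ) + Complex.I * (x 1 : ℂ))
  set H2 := h2 ((x 0 : ℂ) + Complex.I * (x 1 : ℂ))
  push_cast
  linear_combination (-(2 * (x 2 : ℂ) * p1 (x 2)) - p (x 2)) * hw +
    (m ^ 2 * p (x 2) * H + (x 2 : ℂ) ^ 2 * p (x 2) * H2) * Complex.I_sq

end Axial

end BallPSWF
namespace BallPSWF

open Filter Topology Set

/-! ### Solid harmonics with frozen norm -/

/-- The complex solid harmonic `r^{n-m} P_{n-m}^{(m,m)}(y₃ / r) (y₁ + i y₂)^m`, in which the norm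
`r` is treated as an independent parameter. -/
noncomputable def solidZ (n m : ℕ) (r : ℝ) (y : E3) : ℂ :=
  ((r : ℂ) ^ (n - m) * (((jacobiPoly (n - m) m).eval (y 2 / r) : ℝ) : ℂ)) * planar y ^ m

theorem contDiff_planar : ContDiff ℝ ∞ planar :=
  (contDiff_coord 0).add (contDiff_const.mul (contDiff_coord 1))

theorem contDiff_solidZ (n m : ℕ) (r : ℝ) : ContDiff ℝ ∞ (solidZ n m r) := by
  have h2 : ContDiff ℝ ∞ fun y : E3 => y 2 / r :=
    (EuclideanSpace.proj (𝕜 := ℝ) (2 : Fin 3)).contDiff.div_const r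
  have hP : ContDiff ℝ ∞ fun t : ℝ => (jacobiPoly (n - m) m).eval t := by
    simpa only [Polynomial.coe_aeval_eq_eval] using
      Polynomial.contDiff_aeval (𝕜 := ℝ) (jacobiPoly (n - m) m) ∞
  exact (contDiff_const.mul (Complex.ofRealCLM.contDiff.comp (hP.comp h2))).mul (contDiff_planar.pow m)

theorem hasDerivAt_eval_div (P : Polynomial ℝ) (z : ℂ) (r t : ℝ) :
    HasDerivAt (fun t : ℝ => z * ((P.eval (t / r) : ℝ) : ℂ))
      (z / r * ((P.derivative.eval (t / r) : ℝ) : ℂ)) t := by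
  have h1 := (P.hasDerivAt (t / r)).comp t ((hasDerivAt_id t).div_const r)
  refine (h1.ofReal_comp.const_mul z).congr_deriv ?_
  push_cast
  ring

theorem hasDerivAt_const_mul_pow (a : ℂ) (m : ℕ) (w : ℂ) :
    HasDerivAt (fun w : ℂ => a * w ^ m) (a * (m * w ^ (m - 1))) w :=
  (hasDerivAt_pow m w).const_mul a

theorem rotD_two_solidZ (n m : ℕ) (r : ℝ) (x : E3) :
    rotD 2 (solidZ n m r) x = Complex.I * m * solidZ n m r x := by
  refine rotD_two_axial (fun t => hasDerivAt_eval_div (jacobiPoly (n - m) m) _ r t)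
    (fun w => hasDerivAt_pow m w) (fun w => ?_) x
  rcases m with _ | m
  · simp
  · simp only [Nat.add_sub_cancel]
    ring

theorem rotD_zero (i : Fin 3) (f : E3 → ℂ) : rotD i f 0 = 0 := by simp [rotD]

theorem casimir_solidZ {n m : ℕ} (hn : 1 ≤ n) (hm : m ≤ n) (x : E3) :
    ∑ i, rotD i (rotD i (solidZ n m ‖x‖)) x = -(n * (n + 1)) * solidZ n m ‖x‖ x := by
  rcases eq_or_ne x 0 with rfl | hx
  -- Rotations fix the origin, so the solid harmonic has to vanish there; as `1 ≤ n`, one of the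
  -- exponents `m`, `n - m` is positive.
  · simp only [rotD_zero, Finset.sum_const_zero]
    rcases hm.eq_or_lt with rfl | h
    · rw [solidZ, show planar 0 = 0 by simp [planar], zero_pow (by omega), mul_zero, mul_zero]
    · rw [solidZ, norm_zero, Complex.ofReal_zero, zero_pow (by omega), zero_mul, zero_mul, mul_zero]
  have hr : (‖x‖ : ℂ) ≠ 0 := by simpa using hx
  have hr' : ‖x‖ ≠ 0 := by simpa using hx
  have h := casimir_axial (fun t => hasDerivAt_eval_div (jacobiPoly (n - m) m) _ ‖x‖ t)
    (fun t => hasDerivAt_eval_div (jacobiPoly (n - m) m).derivative _ ‖x‖ t)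
    (fun w => hasDerivAt_pow m w) (fun w => hasDerivAt_const_mul_pow m (m - 1) w) (m := m)
    (fun w => by
      rcases m with _ | m
      · simp
      · simp only [Nat.add_sub_cancel]
        ring) x (p := fun t => (‖x‖ : ℂ) ^ (n - m) *
          (((jacobiPoly (n - m) m).eval (t / ‖x‖) : ℝ) : ℂ))
  refine h.trans ?_
  -- The Jacobi equation with `k = n - m` gives the eigenvalue, since `(n-m)(n+m+1) + m(m+1) =
  -- n(n+1)`.
  have hode := congrArg (fun q => q.eval (x 2 / ‖x‖)) (jacobiPoly_ode (n - m) m)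
  simp only [Polynomial.eval_add, Polynomial.eval_sub, Polynomial.eval_mul, Polynomial.eval_pow,
    Polynomial.eval_one, Polynomial.eval_X, Polynomial.eval_natCast, Polynomial.eval_zero,
    Polynomial.eval_ofNat] at hode
  have hode' := congrArg (fun t : ℝ => (t : ℂ)) hode
  have hns : (‖x‖ : ℂ) ^ 2 = (x 0 : ℂ) ^ 2 + (x 1 : ℂ) ^ 2 + (x 2 : ℂ) ^ 2 := by
    have := norm_sq_eq_sum x
    rw [Fin.sum_univ_three] at this
    exact_mod_cast this
  have h01 : (x 0 : ℂ) ^ 2 + (x 1 : ℂ) ^ 2 = (1 - (x 2 / ‖x‖ : ℂ) ^ 2) * ‖x‖ ^ 2 := by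
    field_simp
    linear_combination -hns
  rw [h01, solidZ]
  push_cast [Nat.cast_sub hm] at hode'
  set P0 : ℂ := (((jacobiPoly (n - m) m).eval (x 2 / ‖x‖) : ℝ) : ℂ)
  set P1 : ℂ := (((jacobiPoly (n - m) m).derivative.eval (x 2 / ‖x‖) : ℝ) : ℂ)
  set P2 : ℂ := (((jacobiPoly (n - m) m).derivative.derivative.eval (x 2 / ‖x‖) : ℝ) : ℂ)
  set η : ℂ := (x 2 / ‖x‖ : ℂ) with hη
  have hx2 : (x 2 : ℂ) = η * ‖x‖ := by
    rw [hη]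
    field_simp
  set N : ℂ := (‖x‖ : ℂ) ^ (n - m)
  have a1 : N / ‖x‖ / ‖x‖ * (‖x‖ : ℂ) ^ 2 = N := by field_simp
  have a2 : N / ‖x‖ * (‖x‖ : ℂ) = N := by field_simp
  rw [hx2]
  linear_combination planar x ^ m * N * hode' + (1 - η ^ 2) * P2 * planar x ^ m * a1 -
    (2 * m + 2) * η * P1 * planar x ^ m * a2

/-- The real or the imaginary part, depending on the index of the spherical harmonic. -/
noncomputable def part (l : ℕ) : ℂ →L[ℝ] ℂ :=
  Complex.ofRealCLM.comp (if l = 1 ∨ Even l then Complex.reCLM else Complex.imCLM)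

/-- The normalization constant of the spherical harmonic. -/
noncomputable def coeffY (n l : ℕ) : ℝ :=
  (if l = 1 then 1 / √(8 * Real.pi) else 1 / (2 ^ (l / 2 + 1) * √Real.pi)) /
    √(((n - l / 2 + l / 2).factorial : ℝ) ^ 2 /
      (2 * (2 * (n - l / 2 : ℕ) + 2 * (l / 2 : ℕ) + 1) * ((n - l / 2).factorial : ℝ) *
        ((n - l / 2 + 2 * (l / 2)).factorial : ℝ)))

theorem coeffY_odd (n : ℕ) {m : ℕ} (hm : 1 ≤ m) : coeffY n (2 * m + 1) = coeffY n (2 * m) := by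
  simp only [coeffY, show 2 * m / 2 = m by omega, show (2 * m + 1) / 2 = m by omega,
    if_neg (show ¬ 2 * m = 1 by omega), if_neg (show ¬ 2 * m + 1 = 1 by omega)]

theorem harmonicY_eq (n l : ℕ) (x : E3) :
    (harmonicY n l x : ℂ) = coeffY n l * part l (solidZ n (l / 2) ‖x‖ x) := by
  have hw : (⟨x 0, x 1⟩ : ℂ) = planar x := by
    rw [planar, mul_comm]
    exact Complex.mk_eq_add_mul_I _ _
  have hpart : ∀ (r : ℝ) (z : ℂ), part l (r * z) =
      ((r * (if l = 1 ∨ Even l then z.re else z.im) : ℝ) : ℂ) := by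
    intro r z
    by_cases h : l = 1 ∨ Even l <;> simp [part, h]
  have hZ : solidZ n (l / 2) ‖x‖ x = ((‖x‖ ^ (n - l / 2) *
      classicalJacobi (n - l / 2) (l / 2) (x 2 / ‖x‖) : ℝ) : ℂ) * planar x ^ (l / 2) := by
    rw [solidZ, eval_jacobiPoly]
    push_cast
    ring
  rw [hZ, hpart, ← Complex.ofReal_mul, harmonicY, coeffY, jacobi, jacobi, hw]
  congr 1
  by_cases h1 : l = 1
  · subst h1
    simp
    ring
  · by_cases h2 : Even l <;> simp [h1, h2] <;> ring

/-- The scalar field `g(2 ‖x‖² - 1) Y_ℓ^n(x)` with frozen norm. -/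
noncomputable def frozenSector (g : ℝ → ℂ) (n l : ℕ) (r : ℝ) (y : E3) : ℂ :=
  (g (2 * r ^ 2 - 1) * coeffY n l) * part l (solidZ n (l / 2) r y)

theorem sectorFun_eq_frozenSector (g : ℝ → ℂ) (n l : ℕ) (x : E3) :
    sectorFun g n l x = frozenSector g n l ‖x‖ x := by
  rw [sectorFun, harmonicY_eq, frozenSector]
  ring

theorem contDiff_frozenSector (g : ℝ → ℂ) (n l : ℕ) (r : ℝ) :
    ContDiff ℝ ∞ (frozenSector g n l r) :=
  contDiff_const.mul ((part l).contDiff.comp (contDiff_solidZ n (l / 2) r))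

/-- Rotation fields have real coefficients and so commute with real-linear maps such as `part l`;
identities for complex solid harmonics pass to their real and imaginary parts. -/
theorem rotD_const_mul_clm (i : Fin 3) (z : ℂ) (L : ℂ →L[ℝ] ℂ) {f : E3 → ℂ}
    (hf : ContDiff ℝ ∞ f) :
    rotD i (fun y => z * L (f y)) = fun y => z * L (rotD i f y) := by
  ext y
  have hd := hf.differentiable (by simp) y
  have h1 : HasFDerivAt (fun y => L (f y)) (L.comp (fderiv ℝ f y)) y :=
    L.hasFDerivAt.comp y hd.hasFDerivAt
  rw [rotD, (h1.const_mul z).fderiv]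
  simp [rotD]

/-! ### Angular operators on smooth extensions of sector functions -/

section Extension

variable {g : ℝ → ℂ} {n l : ℕ} {f : E3 → ℂ}

theorem rotD_extension (hf : ContDiff ℝ ∞ f) (h : ∀ x ∈ ball, f x = sectorFun g n l x)
    (i : Fin 3) {x : E3} (hx : x ∈ ball) : rotD i f x = rotD i (frozenSector g n l ‖x‖) x :=
  rotD_eq_of_frozen (hf.differentiable (by simp))
    (fun r => (contDiff_frozenSector g n l r).differentiable (by simp))
    (fun x hx => by rw [h x hx, sectorFun_eq_frozenSector]) i hx

/-- Freezing the norm can be repeated, because `rotD i f` again agrees on the ball with a function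
frozen at `‖x‖`. No regularity of `g` enters. -/
theorem rotD_rotD_extension (hf : ContDiff ℝ ∞ f) (h : ∀ x ∈ ball, f x = sectorFun g n l x)
    (i : Fin 3) {x : E3} (hx : x ∈ ball) :
    rotD i (rotD i f) x = rotD i (rotD i (frozenSector g n l ‖x‖)) x :=
  rotD_eq_of_frozen (Φ := fun r => rotD i (frozenSector g n l r))
    ((contDiff_rotD i hf).differentiable (by simp))
    (fun r => (contDiff_rotD i (contDiff_frozenSector g n l r)).differentiable (by simp))
    (fun _ hx => rotD_extension hf h i hx) i hx

theorem rotD_frozenSector (i : Fin 3) (r : ℝ) :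
    rotD i (frozenSector g n l r) =
      fun y => (g (2 * r ^ 2 - 1) * coeffY n l) * part l (rotD i (solidZ n (l / 2) r) y) :=
  rotD_const_mul_clm i _ _ (contDiff_solidZ n (l / 2) r)

theorem rotD_rotD_frozenSector (i : Fin 3) (r : ℝ) (x : E3) :
    rotD i (rotD i (frozenSector g n l r)) x =
      (g (2 * r ^ 2 - 1) * coeffY n l) * part l (rotD i (rotD i (solidZ n (l / 2) r)) x) := by
  rw [rotD_frozenSector, rotD_const_mul_clm i _ _ (contDiff_rotD i (contDiff_solidZ n (l / 2) r))]

theorem casimir_extension (hn : 1 ≤ n) (hl : l ≤ 2 * n + 1) (hf : ContDiff ℝ ∞ f)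
    (h : ∀ x ∈ ball, f x = sectorFun g n l x) {x : E3} (hx : x ∈ ball) :
    ∑ i, rotD i (rotD i f) x = -(n * (n + 1)) * f x := by
  simp only [rotD_rotD_extension hf h _ hx, rotD_rotD_frozenSector]
  rw [← Finset.mul_sum, ← map_sum, casimir_solidZ hn (by omega), h x hx,
    sectorFun_eq_frozenSector, frozenSector]
  -- The map `part l` is only real-linear, so the eigenvalue is rewritten as a real scalar before
  -- being pulled out.
  have e : (-((n : ℂ) * (n + 1))) * solidZ n (l / 2) ‖x‖ x =
      (-((n : ℝ) * (n + 1))) • solidZ n (l / 2) ‖x‖ x := by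
    rw [Complex.real_smul]
    push_cast
    rfl
  rw [e, map_smul, Complex.real_smul]
  push_cast
  ring

theorem rotD_two_rotD_two_extension (hf : ContDiff ℝ ∞ f)
    (h : ∀ x ∈ ball, f x = sectorFun g n l x) {x : E3} (hx : x ∈ ball) :
    rotD 2 (rotD 2 f) x = -((l / 2 : ℕ) : ℂ) ^ 2 * f x := by
  rw [rotD_rotD_extension hf h _ hx, rotD_rotD_frozenSector]
  have e1 : rotD 2 (solidZ n (l / 2) ‖x‖) =
      fun y => (Complex.I * (l / 2 : ℕ)) * ContinuousLinearMap.id ℝ ℂ (solidZ n (l / 2) ‖x‖ y) := by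
    ext y
    exact rotD_two_solidZ n (l / 2) ‖x‖ y
  have e2 : rotD 2 (rotD 2 (solidZ n (l / 2) ‖x‖)) x =
      (-((l / 2 : ℕ) : ℝ) ^ 2) • solidZ n (l / 2) ‖x‖ x := by
    rw [e1, rotD_const_mul_clm 2 _ _ (contDiff_solidZ n (l / 2) ‖x‖), Complex.real_smul]
    beta_reduce
    rw [rotD_two_solidZ]
    simp only [ContinuousLinearMap.id_apply]
    push_cast
    linear_combination ((l / 2 : ℕ) : ℂ) ^ 2 * solidZ n (l / 2) ‖x‖ x * Complex.I_sq
  rw [e2, map_smul, h x hx, sectorFun_eq_frozenSector, frozenSector, Complex.real_smul]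
  push_cast
  ring

theorem rotD_two_extension_even {m : ℕ} (hf : ContDiff ℝ ∞ f) (hm : 1 ≤ m)
    (h : ∀ x ∈ ball, f x = sectorFun g n (2 * m) x) {x : E3} (hx : x ∈ ball) :
    rotD 2 f x = -(m : ℂ) * sectorFun g n (2 * m + 1) x := by
  have e1 : 2 * m / 2 = m := by omega
  have e2 : (2 * m + 1) / 2 = m := by omega
  rw [rotD_extension hf h _ hx, rotD_frozenSector, sectorFun_eq_frozenSector, frozenSector, coeffY_odd n hm,
    e1, e2]
  beta_reduce
  rw [rotD_two_solidZ]
  have hp1 : part (2 * m) (Complex.I * m * solidZ n m ‖x‖ x) =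
      -(m : ℂ) * part (2 * m + 1) (solidZ n m ‖x‖ x) := by
    have : ¬ (2 * m + 1 = 1 ∨ Even (2 * m + 1)) := by
      rw [Nat.even_add_one]
      simp
      omega
    simp only [part, this, if_false, even_two_mul, or_true, if_true]
    simp
  simp only [hp1]
  ring

end Extension

theorem harmonicY_neg {n l : ℕ} (hl : l ≤ 2 * n + 1) (x : E3) :
    harmonicY n l (-x) = (-1) ^ n * harmonicY n l x := by
  have hw : (⟨(-x) 0, (-x) 1⟩ : ℂ) = -1 * (⟨x 0, x 1⟩ : ℂ) := by
    apply Complex.ext <;> simp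
  have hj : ∀ k m, jacobi k m ((-x) 2 / ‖x‖) = (-1) ^ k * jacobi k m (x 2 / ‖x‖) := by
    intro k m
    rw [PiLp.neg_apply, neg_div, jacobi, jacobi, classicalJacobi_neg]
    ring
  have hpow : (-1 : ℝ) ^ n = (-1) ^ (n - l / 2) * (-1) ^ (l / 2) := by
    rw [← pow_add]
    congr 1
    omega
  have hc : ((-1 : ℂ)) ^ (l / 2) = (((-1 : ℝ) ^ (l / 2) : ℝ) : ℂ) := by push_cast; rfl
  rw [harmonicY, harmonicY, hw, mul_pow, hc, Complex.re_ofReal_mul, Complex.im_ofReal_mul]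
  simp only [norm_neg, hj]
  split_ifs
  · ring
  · rw [hpow]
    ring
  · rw [hpow]
    ring

end BallPSWF
namespace BallPSWF

open Filter Topology Set ComplexConjugate

/-! ### The finite Fourier transform -/

/-- The bilinear form `(c / 2π) ⟨τ, x⟩`, for which the finite Fourier transform is an instance of
the general Fourier integral. -/
noncomputable def pairing (c : ℝ) : E3 →L[ℝ] E3 →L[ℝ] ℝ := (c / (2 * Real.pi)) • innerSL ℝ

theorem fourierChar_pairing (c : ℝ) (τ x : E3) :
    ((Real.fourierChar (-(pairing c).toLinearMap₁₂ τ x) : Circle) : ℂ) =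
      Complex.exp (-(Complex.I * (c : ℂ) * ((inner ℝ x τ : ℝ) : ℂ))) := by
  rw [Real.fourierChar_apply]
  congr 1
  have h : (pairing c).toLinearMap₁₂ τ x = c / (2 * Real.pi) * inner ℝ x τ := by
    rw [real_inner_comm]
    rfl
  rw [h]
  have : (Real.pi : ℂ) ≠ 0 := by simp [Real.pi_ne_zero]
  push_cast
  field_simp

theorem finiteFourier_eq {V : Type*} [NormedAddCommGroup V] [NormedSpace ℂ V] (α c : ℝ)
    (f : E3 → V) :
    finiteFourier α c f =
      VectorFourier.fourierIntegral Real.fourierChar (weight α) (pairing c).toLinearMap₁₂ f := by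
  ext x
  rw [finiteFourier, VectorFourier.fourierIntegral]
  refine integral_congr_ae (ae_of_all _ fun τ => ?_)
  simp only [Circle.smul_def, fourierChar_pairing]

theorem finiteFourier_congr {V : Type*} [NormedAddCommGroup V] [NormedSpace ℂ V] (α c : ℝ)
    {f g : E3 → V} (h : ∀ x ∈ ball, f x = g x) : finiteFourier α c f = finiteFourier α c g := by
  ext x
  refine integral_congr_ae ?_
  filter_upwards [ae_mem_ball α] with τ hτ
  simp only [h τ hτ]

/-- The measure lives on the unit ball, so every moment of an integrable function is finite and
differentiation under the integral is unlimited. -/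
theorem contDiff_finiteFourier {α : ℝ} (c : ℝ) {f : E3 → ℂ} (hf : Integrable f (weight α)) :
    ContDiff ℝ ∞ (finiteFourier α c f) := by
  rw [finiteFourier_eq]
  refine VectorFourier.contDiff_fourierIntegral (pairing c) fun n _ => ?_
  refine hf.norm.mono' ((continuous_norm.pow n).aestronglyMeasurable.mul
    hf.norm.aestronglyMeasurable) ?_
  filter_upwards [ae_mem_ball α] with x hx
  have h1 : ‖x‖ ≤ 1 := by simpa [ball] using hx
  rw [norm_mul, norm_pow, norm_norm, norm_norm]
  exact mul_le_of_le_one_left (norm_nonneg _) (pow_le_one₀ (norm_nonneg _) h1)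

/-- The kernel of the finite Fourier transform. -/
noncomputable def kern (c : ℝ) (x τ : E3) : ℂ :=
  Complex.exp (-(Complex.I * (c : ℂ) * ((inner ℝ x τ : ℝ) : ℂ)))

theorem hasFDerivAt_kern (c : ℝ) (x τ : E3) :
    HasFDerivAt (kern c x)
      (kern c x τ • (-(Complex.I * (c : ℂ))) • Complex.ofRealCLM.comp (innerSL ℝ x)) τ := by
  have h1 : HasFDerivAt (fun τ : E3 => ((inner ℝ x τ : ℝ) : ℂ))
      (Complex.ofRealCLM.comp (innerSL ℝ x)) τ :=
    (Complex.ofRealCLM.comp (innerSL ℝ x)).hasFDerivAt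
  have h2 := (h1.const_mul (-(Complex.I * (c : ℂ)))).cexp
  have e : kern c x = fun τ => Complex.exp (-(Complex.I * (c : ℂ)) * ((inner ℝ x τ : ℝ) : ℂ)) := by
    ext τ
    rw [kern, neg_mul]
  rw [e]
  exact h2

theorem contDiff_kern (c : ℝ) (x : E3) : ContDiff ℝ ∞ (kern c x) := by
  have h1 : ContDiff ℝ ∞ fun τ : E3 => ((inner ℝ x τ : ℝ) : ℂ) :=
    (Complex.ofRealCLM.comp (innerSL ℝ x)).contDiff
  exact (contDiff_const.mul h1).neg.cexp

/-- The kernel is invariant under simultaneous rotation of `x` and `τ`, so its rotation derivative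
in `τ` is minus the one in `x`. -/
theorem rotD_kern (i : Fin 3) (c : ℝ) (x τ : E3) :
    rotD i (kern c x) τ = Complex.I * c * inner ℝ (rotVec i x) τ * kern c x τ := by
  rw [rotD, (hasFDerivAt_kern c x τ).fderiv, inner_rotVec_left]
  simp
  ring

/-- The finite Fourier transform commutes with rotation fields. -/
theorem finiteFourier_rotD {α : ℝ} (hα : -1 < α) (c : ℝ) (i : Fin 3) {f : E3 → ℂ}
    (hf : ContDiff ℝ ∞ f) (x : E3) :
    finiteFourier α c (rotD i f) x = rotD i (finiteFourier α c f) x := by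
  have hfi := integrable_of_continuous hα hf.continuous
  have hfi' : Integrable (fun v => ‖v‖ * ‖f v‖) (weight α) :=
    integrable_of_continuous hα (continuous_norm.mul hf.continuous.norm)
  have hd : HasFDerivAt (finiteFourier α c f) (VectorFourier.fourierIntegral Real.fourierChar
      (weight α) (pairing c).toLinearMap₁₂ (VectorFourier.fourierSMulRight (pairing c) f) x) x := by
    rw [finiteFourier_eq]
    exact VectorFourier.hasFDerivAt_fourierIntegral (pairing c) hfi hfi' x
  have hint : Integrable (fun v => Real.fourierChar (-(pairing c).toLinearMap₁₂ v x) •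
      VectorFourier.fourierSMulRight (pairing c) f v) (weight α) := by
    refine (VectorFourier.fourierIntegral_convergent_iff Real.continuous_fourierChar
      (by apply (pairing c).continuous₂) x).2 ?_
    refine (hfi'.const_mul (2 * Real.pi * ‖pairing c‖)).mono'
      hfi.aestronglyMeasurable.fourierSMulRight (ae_of_all _ fun v => ?_)
    rw [← mul_assoc]
    exact VectorFourier.norm_fourierSMulRight_le _ _ _
  have h1 : rotD i (finiteFourier α c f) x =
      ∫ τ, -(Complex.I * c * inner ℝ (rotVec i x) τ * kern c x τ) * f τ ∂weight α := by
    rw [rotD, hd.fderiv, VectorFourier.fourierIntegral, ContinuousLinearMap.integral_apply hint]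
    refine integral_congr_ae (ae_of_all _ fun τ => ?_)
    have hp : pairing c τ (rotVec i x) = c / (2 * Real.pi) * inner ℝ (rotVec i x) τ := by
      rw [real_inner_comm]
      rfl
    have : (Real.pi : ℂ) ≠ 0 := by simp [Real.pi_ne_zero]
    simp only [Circle.smul_def, fourierChar_pairing, _root_.smul_apply,
      VectorFourier.fourierSMulRight_apply, hp, Complex.real_smul, smul_eq_mul, kern]
    push_cast
    field_simp
  have h2 : finiteFourier α c (rotD i f) x = ∫ τ, kern c x τ * rotD i f τ ∂weight α := rfl
  -- Skew-symmetry moves the rotation from `f` to the kernel; the two minus signs, from this and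
  -- from `rotD_kern`, cancel.
  have h3 := integral_rotD_mul hα i (contDiff_kern c x) hf
  rw [h1, h2, ← neg_neg (∫ τ, kern c x τ * rotD i f τ ∂weight α), ← h3, ← integral_neg]
  refine integral_congr_ae (ae_of_all _ fun τ => ?_)
  simp only [rotD_kern]
  ring

theorem integral_finiteFourier_symm {α : ℝ} (c : ℝ) {f g : E3 → ℂ}
    (hα : -1 < α) (hf : Integrable f (weight α)) (hg : Integrable g (weight α)) :
    ∫ x, finiteFourier α c f x * g x ∂weight α = ∫ x, f x * finiteFourier α c g x ∂weight α := by
  have := isFiniteMeasure_weight hα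
  have hflip : (pairing c).toLinearMap₁₂.flip = (pairing c).toLinearMap₁₂ := by
    ext x y
    change c / (2 * Real.pi) * inner ℝ y x = c / (2 * Real.pi) * inner ℝ x y
    rw [real_inner_comm]
  have h := VectorFourier.integral_fourierIntegral_smul_eq_flip (L := (pairing c).toLinearMap₁₂)
    Real.continuous_fourierChar (by apply (pairing c).continuous₂) hf hg
  rw [hflip, ← finiteFourier_eq, ← finiteFourier_eq] at h
  exact h

theorem finiteFourier_conj (α c : ℝ) (f : E3 → ℂ) (x : E3) :
    finiteFourier α c (fun y => conj (f y)) x = conj (finiteFourier α c f (-x)) := by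
  rw [finiteFourier, finiteFourier, ← integral_conj]
  refine integral_congr_ae (ae_of_all _ fun τ => ?_)
  simp only [smul_eq_mul, map_mul, ← Complex.exp_conj, map_neg, Complex.conj_I,
    Complex.conj_ofReal, inner_neg_left, Complex.ofReal_neg]
  congr 2
  ring

theorem finiteFourier_const_mul (α c : ℝ) (z : ℂ) (f : E3 → ℂ) (x : E3) :
    finiteFourier α c (fun y => z * f y) x = z * finiteFourier α c f x := by
  rw [finiteFourier, finiteFourier, ← integral_const_mul]
  refine integral_congr_ae (ae_of_all _ fun τ => ?_)
  simp only [smul_eq_mul]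
  ring

theorem finiteFourier_pi {α : ℝ} (c : ℝ) {f : E3 → Fin 3 → ℂ} (hα : -1 < α)
    (hf : ∀ i, Continuous fun x => f x i) (x : E3) (i : Fin 3) :
    finiteFourier α c f x i = finiteFourier α c (fun y => f y i) x := by
  rw [finiteFourier, eval_integral]
  · rfl
  · intro j
    exact integrable_of_continuous hα ((contDiff_kern c x).continuous.smul (hf j))

end BallPSWF
namespace BallPSWF

open Filter Topology Set ComplexConjugate

/-! ### Scalar ball prolate spheroidal wave functions -/

theorem partialD_const_mul (i : Fin 3) (z : ℂ) (f : E3 → ℂ) (x : E3) :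
    partialD i (fun y => z * f y) x = z * partialD i f x := by
  have h' : fderiv ℝ (fun y => z * f y) x = z • fderiv ℝ f x :=
    congrFun (fderiv_const_smul_field (𝕜 := ℝ) (f := f) z) x
  rw [partialD, h']
  rfl

theorem rotD_const_mul (i : Fin 3) (z : ℂ) (f : E3 → ℂ) (x : E3) :
    rotD i (fun y => z * f y) x = z * rotD i f x := by
  rw [rotD, rotD, fderiv_eq_sum, fderiv_eq_sum, Finset.mul_sum]
  refine Finset.sum_congr rfl fun j _ => ?_
  rw [partialD_const_mul]
  ring

theorem sturmLiouville_const_mul (α c : ℝ) (z : ℂ) (f : E3 → ℂ) (x : E3) :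
    sturmLiouville α c (fun y => z * f y) x = z * sturmLiouville α c f x := by
  have hs : ∀ y (i : Fin 3), (((1 - ‖y‖ ^ 2) ^ α : ℝ) : ℂ) * (z * partialD i f y -
      (y i : ℂ) * ∑ j : Fin 3, (y j : ℂ) * (z * partialD j f y)) =
      z * ((((1 - ‖y‖ ^ 2) ^ α : ℝ) : ℂ) * (partialD i f y -
      (y i : ℂ) * ∑ j : Fin 3, (y j : ℂ) * partialD j f y)) := by
    intro y i
    simp only [Fin.sum_univ_three]
    ring
  rw [sturmLiouville, divergence]
  simp only [partialD_const_mul, hs]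
  rw [sturmLiouville, divergence, ← Finset.mul_sum]
  ring

theorem conj_rotD (i : Fin 3) (f : E3 → ℂ) (x : E3) :
    rotD i (fun y => conj (f y)) x = conj (rotD i f x) := by
  have h := Complex.conjCLE.comp_fderiv (f := f) (x := x)
  have h' : fderiv ℝ (fun y => conj (f y)) x = _ := h
  rw [rotD, h']
  rfl

theorem sectorFun_conj (g : ℝ → ℂ) (n l : ℕ) (x : E3) :
    sectorFun (fun s => conj (g s)) n l x = conj (sectorFun g n l x) := by
  rw [sectorFun, sectorFun, map_mul, Complex.conj_ofReal]

theorem sectorFun_neg (g : ℝ → ℂ) {n l : ℕ} (hl : l ≤ 2 * n + 1) (x : E3) :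
    sectorFun g n l (-x) = (-1) ^ n * sectorFun g n l x := by
  rw [sectorFun, sectorFun, harmonicY_neg hl, norm_neg]
  push_cast
  ring

/-- The eigenvalue `(-i)^{n+2k} λ` of the finite Fourier transform. -/
noncomputable def eigenvalue (lam : ℕ → ℕ → ℝ) (n k : ℕ) : ℂ :=
  (-Complex.I) ^ (n + 2 * k) * (lam n k : ℂ)

/-- Conjugation turns the transform at `x` into the one at `-x`, which costs the parity `(-1)^n` of
the sector. That sign exactly compensates the conjugation of `(-i)^{n+2k}`, so a wave function and
its conjugate share an eigenvalue. -/
theorem conj_eigenvalue (lam : ℕ → ℕ → ℝ) (n k : ℕ) :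
    conj (eigenvalue lam n k) * (-1) ^ n = eigenvalue lam n k := by
  have h : (Complex.I) ^ (n + 2 * k) = (-1) ^ n * (-Complex.I) ^ (n + 2 * k) := by
    rw [neg_pow Complex.I (n + 2 * k), ← mul_assoc, ← pow_add,
      show n + (n + 2 * k) = 2 * (n + k) by ring, pow_mul]
    simp
  rw [eigenvalue, map_mul, map_pow, map_neg, Complex.conj_I, neg_neg, Complex.conj_ofReal, h]
  have h1 : ((-1 : ℂ) ^ n) * (-1) ^ n = 1 := by
    rw [← mul_pow]
    simp
  linear_combination (-Complex.I) ^ (n + 2 * k) * (lam n k : ℂ) * h1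

section

variable {α c : ℝ} {φ : ℕ → ℕ → ℝ → ℂ} {lam : ℕ → ℕ → ℝ}

theorem norm_eigenvalue (hφ : IsBallPSWF α c φ lam) (n k : ℕ) :
    ‖eigenvalue lam n k‖ = lam n k := by
  rw [eigenvalue, norm_mul, norm_pow, norm_neg, Complex.norm_I, one_pow, one_mul,
    Complex.norm_real, Real.norm_of_nonneg (hφ.lam_pos n k).le]

theorem eigenvalue_ne_zero (hφ : IsBallPSWF α c φ lam) (n k : ℕ) : eigenvalue lam n k ≠ 0 := by
  rw [← norm_ne_zero_iff, norm_eigenvalue hφ]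
  exact (hφ.lam_pos n k).ne'

theorem eigenvalue_injective (hφ : IsBallPSWF α c φ lam) {n : ℕ} (hanti : StrictAnti (lam n))
    {k j : ℕ} (h : eigenvalue lam n k = eigenvalue lam n j) : k = j := by
  refine hanti.injective ?_
  rw [← norm_eigenvalue hφ, ← norm_eigenvalue hφ, h]

/-- The wave functions extend smoothly to the whole space, as eigenfunctions of the finite Fourier
transform. -/
theorem exists_extension (hα : -1 < α) (hφ : IsBallPSWF α c φ lam) {n l : ℕ} (k : ℕ) (hl : 1 ≤ l)
    (hl' : l ≤ 2 * n + 1) :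
    ∃ f : E3 → ℂ, ContDiff ℝ ∞ f ∧ (∀ x ∈ ball, f x = sectorFun (φ n k) n l x) ∧
      finiteFourier α c f = fun x => eigenvalue lam n k * f x := by
  have := isFiniteMeasure_weight hα
  have hμ := eigenvalue_ne_zero hφ n k
  have hint : Integrable (sectorFun (φ n k) n l) (weight α) :=
    (hφ.memLp n k l hl hl').integrable (by norm_num)
  have heq : ∀ x ∈ ball, (eigenvalue lam n k)⁻¹ * finiteFourier α c (sectorFun (φ n k) n l) x =
      sectorFun (φ n k) n l x := by
    intro x hx
    rw [hφ.eigen n k l hl hl' x hx]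
    exact inv_mul_cancel_left₀ hμ _
  refine ⟨fun x => (eigenvalue lam n k)⁻¹ * finiteFourier α c (sectorFun (φ n k) n l) x,
    contDiff_const.mul (contDiff_finiteFourier c hint), heq, ?_⟩
  rw [finiteFourier_congr α c heq]
  ext x
  rw [mul_inv_cancel_left₀ hμ]

theorem exists_ne_zero (hφ : IsBallPSWF α c φ lam) {n l : ℕ} (k : ℕ) (hl : 1 ≤ l)
    (hl' : l ≤ 2 * n + 1) : ∃ x ∈ Metric.ball (0 : E3) 1, sectorFun (φ n k) n l x ≠ 0 := by
  by_contra! h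
  have h1 := hφ.normalized n k l hl hl'
  rw [integral_eq_zero_of_ae] at h1
  · exact zero_ne_one h1
  · filter_upwards [ae_mem_openBall α] with x hx
    simp [h x hx]

/-- The conjugate is an eigenfunction in the same sector with the same eigenvalue: by parity for the
Fourier transform, by real coefficients and real `χ k` for the Sturm-Liouville operator.
Completeness makes it a multiple of some wave function, and strict monotonicity identifies the
index. -/
theorem exists_conj_eq_mul (hα : -1 < α) (hφ : IsBallPSWF α c φ lam) {n l : ℕ} (k : ℕ)
    (hl : 1 ≤ l) (hl' : l ≤ 2 * n + 1) :
    ∃ z : ℂ, ∀ x ∈ ball, conj (sectorFun (φ n k) n l x) = z * sectorFun (φ n k) n l x := by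
  obtain ⟨x₀, hx₀, hne⟩ := exists_ne_zero hφ k hl hl'
  have hne' : conj (sectorFun (φ n k) n l x₀) ≠ 0 := by simpa using hne
  rcases hφ.arranged n with ⟨hanti, hall⟩ | ⟨χ, hmono, hall⟩
  · have heig : ∀ x ∈ ball, finiteFourier α c (sectorFun (fun s => conj (φ n k s)) n l) x =
        eigenvalue lam n k * sectorFun (fun s => conj (φ n k s)) n l x := by
      intro x hx
      have hx' : -x ∈ ball := by simpa [ball] using hx
      have e : sectorFun (fun s => conj (φ n k s)) n l =
        fun y => conj (sectorFun (φ n k) n l y) := funext fun y => sectorFun_conj _ _ _ y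
      have h1 : finiteFourier α c (sectorFun (φ n k) n l) (-x) =
        eigenvalue lam n k * sectorFun (φ n k) n l (-x) := hφ.eigen n k l hl hl' (-x) hx'
      rw [e, finiteFourier_conj, h1, sectorFun_neg _ hl', map_mul, map_mul, map_pow, map_neg,
        map_one, ← mul_assoc, conj_eigenvalue]
    have hmem : MemLp (sectorFun (fun s => conj (φ n k s)) n l) 2 (weight α) := by
      have h2 := hφ.memLp n k l hl hl'
      have e : sectorFun (fun s => conj (φ n k s)) n l =
        fun y => conj (sectorFun (φ n k) n l y) := funext fun y => sectorFun_conj _ _ _ y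
      rw [e]
      exact h2.of_le (Complex.continuous_conj.comp_aestronglyMeasurable h2.1)
        (ae_of_all _ fun y => by simp)
    obtain ⟨j, z, hz⟩ := hall l hl hl' _ _ (eigenvalue_ne_zero hφ n k) hmem heig
    have hkj : k = j := by
      refine eigenvalue_injective hφ hanti ?_
      have h1 := heig x₀ (openBall_subset hx₀)
      have h2 : finiteFourier α c (sectorFun (φ n j) n l) x₀ =
        eigenvalue lam n j * sectorFun (φ n j) n l x₀ :=
        hφ.eigen n j l hl hl' x₀ (openBall_subset hx₀)
      rw [finiteFourier_congr α c hz, finiteFourier_const_mul, h2, mul_left_comm,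
        ← hz x₀ (openBall_subset hx₀), sectorFun_conj] at h1
      exact (mul_right_cancel₀ hne' h1).symm
    subst hkj
    exact ⟨z, fun x hx => by rw [← sectorFun_conj, hz x hx]⟩
  · obtain ⟨f, hf, hfe, -⟩ := exists_extension hα hφ k hl hl'
    obtain ⟨hsl, hcomplete⟩ := hall l hl hl'
    have hsm : ContDiffOn ℝ ∞ (sectorFun (fun s => conj (φ n k s)) n l) ball := by
      have h1 : ContDiff ℝ ∞ fun x => conj (f x) := Complex.conjCLE.contDiff.comp hf
      refine h1.contDiffOn.congr fun x hx => ?_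
      rw [sectorFun_conj, hfe x hx]
    have heig : ∀ x ∈ Metric.ball (0 : E3) 1,
        sturmLiouville α c (sectorFun (fun s => conj (φ n k s)) n l) x =
          (χ k : ℂ) * sectorFun (fun s => conj (φ n k s)) n l x := by
      intro x hx
      have e : sectorFun (fun s => conj (φ n k s)) n l =
        fun y => conj (sectorFun (φ n k) n l y) := funext fun y => sectorFun_conj _ _ _ y
      rw [e, sturmLiouville_conj, hsl k x hx, map_mul, Complex.conj_ofReal]
    obtain ⟨j, z, hz⟩ := hcomplete _ _ hsm heig
    have hkj : k = j := by
      refine hmono.injective ?_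
      have h1 := heig x₀ hx₀
      rw [sturmLiouville_congr α c hz hx₀, sturmLiouville_const_mul, hsl j x₀ hx₀, mul_left_comm,
        ← hz x₀ (openBall_subset hx₀), sectorFun_conj] at h1
      exact_mod_cast (mul_right_cancel₀ hne' h1).symm
    subst hkj
    exact ⟨z, fun x hx => by rw [← sectorFun_conj, hz x hx]⟩

/-- The wave functions are real. -/
theorem conj_wave (hα : -1 < α) (hφ : IsBallPSWF α c φ lam) {n l : ℕ} (k : ℕ)
    (hl : 1 ≤ l) (hl' : l ≤ 2 * n + 1) :
    ∀ x ∈ ball, conj (sectorFun (φ n k) n l x) = sectorFun (φ n k) n l x := by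
  obtain ⟨z, hz⟩ := exists_conj_eq_mul hα hφ k hl hl'
  have hnorm := hφ.normalized n k l hl hl'
  -- The normalization is conjugated. The value `z = -1` would make the function purely imaginary
  -- and the integral of its square nonpositive.
  have hz2 : z ^ 2 = 1 := by
    have h1 := congrArg conj hnorm
    rw [← integral_conj, map_one] at h1
    have h2 : ∫ x, conj (sectorFun (φ n k) n l x * sectorFun (φ n k) n l x) ∂weight α =
        ∫ x, z ^ 2 * (sectorFun (φ n k) n l x * sectorFun (φ n k) n l x) ∂weight α := by
      refine integral_congr_ae ?_
      filter_upwards [ae_mem_ball α] with x hx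
      rw [map_mul, hz x hx]
      ring
    rw [h2, integral_const_mul, hnorm, mul_one] at h1
    exact h1
  rcases sq_eq_one_iff.1 hz2 with rfl | rfl
  · simpa using hz
  · exfalso
    have h3 : ∫ x, sectorFun (φ n k) n l x * sectorFun (φ n k) n l x ∂weight α =
        ((-∫ x, ‖sectorFun (φ n k) n l x‖ ^ 2 ∂weight α : ℝ) : ℂ) := by
      rw [← integral_neg, ← integral_complex_ofReal]
      refine integral_congr_ae ?_
      filter_upwards [ae_mem_ball α] with x hx
      have h4 := Complex.mul_conj' (sectorFun (φ n k) n l x)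
      rw [hz x hx] at h4
      push_cast
      linear_combination -h4
    rw [hnorm] at h3
    have h5 : (1 : ℝ) = -∫ x, ‖sectorFun (φ n k) n l x‖ ^ 2 ∂weight α := by exact_mod_cast h3
    have h6 : 0 ≤ ∫ x, ‖sectorFun (φ n k) n l x‖ ^ 2 ∂weight α :=
      integral_nonneg fun x => by positivity
    linarith

/-! ### Orthogonality of the scalar wave functions within one degree -/

theorem integral_wave_mul_of_ne (hα : -1 < α) (hφ : IsBallPSWF α c φ lam) {n l k j : ℕ}
    (hl : 1 ≤ l) (hl' : l ≤ 2 * n + 1) (hkj : k ≠ j) :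
    ∫ x, sectorFun (φ n k) n l x * sectorFun (φ n j) n l x ∂weight α = 0 := by
  obtain ⟨f, hf, hfe, hfF⟩ := exists_extension hα hφ k hl hl'
  obtain ⟨g, hg, hge, hgF⟩ := exists_extension hα hφ j hl hl'
  have hfg : ∫ x, sectorFun (φ n k) n l x * sectorFun (φ n j) n l x ∂weight α =
      ∫ x, f x * g x ∂weight α := by
    refine integral_congr_ae ?_
    filter_upwards [ae_mem_ball α] with x hx
    rw [hfe x hx, hge x hx]
  rw [hfg]
  rcases hφ.arranged n with ⟨hanti, -⟩ | ⟨χ, hmono, hall⟩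
  · have h := integral_finiteFourier_symm c hα (integrable_of_continuous hα hf.continuous)
      (integrable_of_continuous hα hg.continuous)
    simp only [hfF, hgF, mul_assoc, mul_left_comm (f _), integral_const_mul] at h
    rw [← sub_eq_zero, ← sub_mul] at h
    refine (mul_eq_zero.1 h).resolve_left (sub_ne_zero.2 fun h' => hkj ?_)
    exact eigenvalue_injective hφ hanti h'
  · have h := integral_sturmLiouville_symm hα c hf hg
    have h2 : ∫ x, (sturmLiouville α c f x * g x - f x * sturmLiouville α c g x) ∂weight α =
        ∫ x, ((χ k : ℂ) - χ j) * (f x * g x) ∂weight α := by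
      refine integral_congr_ae ?_
      filter_upwards [ae_mem_openBall α] with x hx
      rw [sturmLiouville_congr α c hfe hx, sturmLiouville_congr α c hge hx,
        (hall l hl hl').1 k x hx, (hall l hl hl').1 j x hx, hfe x (openBall_subset hx),
        hge x (openBall_subset hx)]
      ring
    rw [h2, integral_const_mul] at h
    refine (mul_eq_zero.1 h).resolve_left (sub_ne_zero.2 fun h' => hkj ?_)
    exact hmono.injective (by exact_mod_cast h')

theorem integral_wave_mul_even_odd (hα : -1 < α) (hφ : IsBallPSWF α c φ lam) {n m : ℕ} (k j : ℕ)
    (hm : 1 ≤ m) (hmn : m ≤ n) :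
    ∫ x, sectorFun (φ n k) n (2 * m) x * sectorFun (φ n j) n (2 * m + 1) x ∂weight α = 0 := by
  obtain ⟨f, hf, hfe, -⟩ := exists_extension hα hφ k (show 1 ≤ 2 * m by omega)
    (show 2 * m ≤ 2 * n + 1 by omega)
  -- Here `g` extends the cosine function, not the sine one. Rotation about the third axis turns
  -- cosine into `-m` times sine, so both product-rule terms equal `-m φ_k φ_j Y_{2m} Y_{2m+1}`, and
  -- their sum integrates to zero.
  obtain ⟨g, hg, hge, -⟩ := exists_extension hα hφ j (show 1 ≤ 2 * m by omega)
    (show 2 * m ≤ 2 * n + 1 by omega)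
  have h := integral_rotD hα 2 (hf.mul hg)
  have h2 : ∫ x, rotD 2 (fun y => f y * g y) x ∂weight α = ∫ x, (-(2 * m : ℂ)) *
      (sectorFun (φ n k) n (2 * m) x * sectorFun (φ n j) n (2 * m + 1) x) ∂weight α := by
    refine integral_congr_ae ?_
    filter_upwards [ae_mem_ball α] with x hx
    rw [rotD_mul 2 (hf.differentiable (by simp) x) (hg.differentiable (by simp) x),
      rotD_two_extension_even hf hm hfe hx, rotD_two_extension_even hg hm hge hx, hfe x hx,
      hge x hx]
    simp only [sectorFun]
    ring
  rw [h2, integral_const_mul] at h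
  refine (mul_eq_zero.1 h).resolve_left (neg_ne_zero.2 (mul_ne_zero two_ne_zero ?_))
  exact_mod_cast (by omega : m ≠ 0)

theorem integral_wave_mul (hα : -1 < α) (hφ : IsBallPSWF α c φ lam) {n l l' : ℕ} (k j : ℕ)
    (hl : 1 ≤ l) (hln : l ≤ 2 * n + 1) (hl' : 1 ≤ l') (hln' : l' ≤ 2 * n + 1) :
    ∫ x, sectorFun (φ n k) n l x * sectorFun (φ n j) n l' x ∂weight α =
      if k = j ∧ l = l' then 1 else 0 := by
  by_cases hll : l = l'
  · subst hll
    by_cases hkj : k = j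
    · subst hkj
      simpa using hφ.normalized n k l hl hln
    · simpa [hkj] using integral_wave_mul_of_ne hα hφ hl hln hkj
  simp only [hll, and_false, if_false]
  by_cases hm : l / 2 = l' / 2
  -- Order zero contains only `l = 1`, so two distinct indices of equal order form a cosine-sine
  -- pair with `1 ≤ m`.
  · obtain ⟨m, hm1, hmn, ⟨rfl, rfl⟩ | ⟨rfl, rfl⟩⟩ : ∃ m, 1 ≤ m ∧ m ≤ n ∧
        ((l = 2 * m ∧ l' = 2 * m + 1) ∨ (l = 2 * m + 1 ∧ l' = 2 * m)) :=
      ⟨l / 2, by omega, by omega, by omega⟩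
    · exact integral_wave_mul_even_odd hα hφ k j hm1 hmn
    · simpa only [mul_comm] using integral_wave_mul_even_odd hα hφ j k hm1 hmn
  · obtain ⟨f, hf, hfe, -⟩ := exists_extension hα hφ k hl hln
    obtain ⟨g, hg, hge, -⟩ := exists_extension hα hφ j hl' hln'
    have hfg : ∫ x, sectorFun (φ n k) n l x * sectorFun (φ n j) n l' x ∂weight α =
        ∫ x, f x * g x ∂weight α := by
      refine integral_congr_ae ?_
      filter_upwards [ae_mem_ball α] with x hx
      rw [hfe x hx, hge x hx]
    rw [hfg]
    -- The square of the rotation about the third axis is symmetric, with eigenvalues `-(l / 2)²`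
    -- and `-(l' / 2)²`.
    have h1 := integral_rotD_mul hα 2 (contDiff_rotD 2 hf) hg
    have h2 := integral_rotD_mul hα 2 hf (contDiff_rotD 2 hg)
    have e1 : ∫ x, rotD 2 (rotD 2 f) x * g x ∂weight α =
        ∫ x, (-((l / 2 : ℕ) : ℂ) ^ 2) * (f x * g x) ∂weight α := by
      refine integral_congr_ae ?_
      filter_upwards [ae_mem_ball α] with x hx
      rw [rotD_two_rotD_two_extension hf hfe hx]
      ring
    have e2 : ∫ x, f x * rotD 2 (rotD 2 g) x ∂weight α =
        ∫ x, (-((l' / 2 : ℕ) : ℂ) ^ 2) * (f x * g x) ∂weight α := by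
      refine integral_congr_ae ?_
      filter_upwards [ae_mem_ball α] with x hx
      rw [rotD_two_rotD_two_extension hg hge hx]
      ring
    rw [e1, h2, e2, integral_const_mul, integral_const_mul, neg_neg] at h1
    have h3 : (((l / 2 : ℕ) : ℂ) ^ 2 - ((l' / 2 : ℕ) : ℂ) ^ 2) * ∫ x, f x * g x ∂weight α = 0 := by
      linear_combination -h1
    refine (mul_eq_zero.1 h3).resolve_left (sub_ne_zero.2 fun h' => hm ?_)
    have h4 : (l / 2) ^ 2 = (l' / 2) ^ 2 := by exact_mod_cast h'
    exact Nat.pow_left_injective two_ne_zero h4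

/-! ### Divergence free ball prolate spheroidal wave functions -/

theorem integral_sum_rotD_mul (hα : -1 < α) {f g : E3 → ℂ} (hf : ContDiff ℝ ∞ f)
    (hg : ContDiff ℝ ∞ g) {z : ℂ} (hz : ∀ x ∈ ball, ∑ i, rotD i (rotD i g) x = -z * g x) :
    ∫ x, ∑ i, rotD i f x * rotD i g x ∂weight α = z * ∫ x, f x * g x ∂weight α := by
  have h1 : ∀ i ∈ Finset.univ, Integrable (fun x => rotD i f x * rotD i g x) (weight α) :=
    fun i _ => integrable_of_continuous hα
      ((contDiff_rotD i hf).continuous.mul (contDiff_rotD i hg).continuous)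
  have h2 : ∀ i ∈ Finset.univ, Integrable (fun x => f x * rotD i (rotD i g) x) (weight α) :=
    fun i _ => integrable_of_continuous hα
      (hf.continuous.mul (contDiff_rotD i (contDiff_rotD i hg)).continuous)
  rw [integral_finsetSum _ h1,
    Finset.sum_congr rfl fun i _ => integral_rotD_mul hα i hf (contDiff_rotD i hg),
    Finset.sum_neg_distrib, ← integral_finsetSum _ h2, ← integral_neg, ← integral_const_mul]
  refine integral_congr_ae ?_
  filter_upwards [ae_mem_ball α] with x hx
  rw [← Finset.mul_sum, hz x hx]
  ring

theorem divFreePSWF_eq {n k l : ℕ} {f : E3 → ℂ} (hf : ContDiff ℝ ∞ f)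
    (hfe : ∀ x ∈ ball, f x = sectorFun (φ n k) n l x) {x : E3} (hx : x ∈ ball) :
    divFreePSWF φ n k l x = fun i => rotD i f x :=
  funext fun i => crossGrad_apply hx (fun y hy => (hfe y hy).symm) (hf.differentiable (by simp) x) i

theorem finiteFourier_divFreePSWF (hα : -1 < α) (hφ : IsBallPSWF α c φ lam) {n l : ℕ} (k : ℕ)
    (hl : 1 ≤ l) (hln : l ≤ 2 * n + 1) {x : E3} (hx : x ∈ ball) :
    finiteFourier α c (divFreePSWF φ n k l) x = eigenvalue lam n k • divFreePSWF φ n k l x := by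
  obtain ⟨f, hf, hfe, hfF⟩ := exists_extension hα hφ k hl hln
  rw [finiteFourier_congr α c fun y hy => divFreePSWF_eq hf hfe hy, divFreePSWF_eq hf hfe hx]
  ext i
  rw [finiteFourier_pi c hα fun j => (contDiff_rotD j hf).continuous]
  have h := finiteFourier_rotD hα c i hf x
  rw [hfF, rotD_const_mul] at h
  exact h

theorem divergence_divFreePSWF (hα : -1 < α) (hφ : IsBallPSWF α c φ lam) {n l : ℕ} (k : ℕ)
    (hl : 1 ≤ l) (hln : l ≤ 2 * n + 1) {x : E3} (hx : x ∈ Metric.ball (0 : E3) 1) :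
    divergence (divFreePSWF φ n k l) x = 0 := by
  obtain ⟨f, hf, hfe, -⟩ := exists_extension hα hφ k hl hln
  rw [← divergence_rotD hf x]
  refine Finset.sum_congr rfl fun i _ => ?_
  have : (fun y => divFreePSWF φ n k l y i) =ᶠ[𝓝 x] fun y => rotD i f y := by
    filter_upwards [Metric.isOpen_ball.mem_nhds hx] with y hy
    rw [divFreePSWF_eq hf hfe (openBall_subset hy)]
  rw [partialD, partialD, this.fderiv_eq]

/-- Since the scalar function is real, the conjugate of its extension is another extension. Both
compute the same field on the ball, and conjugation commutes with `rotD i`. -/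
theorem divFreePSWF_im (hα : -1 < α) (hφ : IsBallPSWF α c φ lam) {n l : ℕ} (k : ℕ)
    (hl : 1 ≤ l) (hln : l ≤ 2 * n + 1) {x : E3} (hx : x ∈ ball) (i : Fin 3) :
    (divFreePSWF φ n k l x i).im = 0 := by
  obtain ⟨f, hf, hfe, -⟩ := exists_extension hα hφ k hl hln
  have hf' : ContDiff ℝ ∞ fun x => conj (f x) := Complex.conjCLE.contDiff.comp hf
  have hfe' : ∀ x ∈ ball, conj (f x) = sectorFun (φ n k) n l x := fun x hx => by
    rw [hfe x hx, conj_wave hα hφ k hl hln x hx]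
  have h1 := congrFun (divFreePSWF_eq hf hfe hx) i
  have h2 := congrFun (divFreePSWF_eq hf' hfe' hx) i
  simp only [conj_rotD] at h2
  rw [← h1] at h2
  exact Complex.conj_eq_iff_im.1 h2.symm

theorem contDiff_rotD_pi {f : E3 → ℂ} (hf : ContDiff ℝ ∞ f) :
    ContDiff ℝ ∞ fun x (i : Fin 3) => rotD i f x :=
  contDiff_pi.2 fun i => contDiff_rotD i hf

theorem contDiffOn_divFreePSWF (hα : -1 < α) (hφ : IsBallPSWF α c φ lam) {n l : ℕ} (k : ℕ)
    (hl : 1 ≤ l) (hln : l ≤ 2 * n + 1) : ContDiffOn ℝ ∞ (divFreePSWF φ n k l) ball := by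
  obtain ⟨f, hf, hfe, -⟩ := exists_extension hα hφ k hl hln
  exact (contDiff_rotD_pi hf).contDiffOn.congr fun x hx => divFreePSWF_eq hf hfe hx

theorem memLp_divFreePSWF (hα : -1 < α) (hφ : IsBallPSWF α c φ lam) {n l : ℕ} (k : ℕ)
    (hl : 1 ≤ l) (hln : l ≤ 2 * n + 1) : MemLp (divFreePSWF φ n k l) 2 (weight α) := by
  obtain ⟨f, hf, hfe, -⟩ := exists_extension hα hφ k hl hln
  refine (memLp_congr_ae ?_).1 (memLp_of_continuous hα (contDiff_rotD_pi hf).continuous 2)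
  filter_upwards [ae_mem_ball α] with x hx
  rw [divFreePSWF_eq hf hfe hx]

theorem integral_divFreePSWF (hα : -1 < α) (hφ : IsBallPSWF α c φ lam) {n l m l' : ℕ} (k j : ℕ)
    (hn : 1 ≤ n) (hl : 1 ≤ l) (hln : l ≤ 2 * n + 1) (hm : 1 ≤ m) (hl' : 1 ≤ l')
    (hlm : l' ≤ 2 * m + 1) :
    ∫ x, divFreePSWF φ n k l x ⬝ᵥ divFreePSWF φ m j l' x ∂weight α =
      if k = j ∧ l = l' ∧ n = m then (n : ℂ) * ((n : ℂ) + 1) else 0 := by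
  obtain ⟨f, hf, hfe, -⟩ := exists_extension hα hφ k hl hln
  obtain ⟨g, hg, hge, -⟩ := exists_extension hα hφ j hl' hlm
  have hdot : ∫ x, divFreePSWF φ n k l x ⬝ᵥ divFreePSWF φ m j l' x ∂weight α =
      ∫ x, ∑ i, rotD i f x * rotD i g x ∂weight α := by
    refine integral_congr_ae ?_
    filter_upwards [ae_mem_ball α] with x hx
    rw [divFreePSWF_eq hf hfe hx, divFreePSWF_eq hg hge hx]
    rfl
  -- Moving the rotations onto either factor gives `m(m+1)` or `n(n+1)` times the same scalar
  -- integral; for `n ≠ m` that integral must vanish.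
  have h1 := integral_sum_rotD_mul hα hf hg fun x hx => casimir_extension hm hlm hg hge hx
  have h2 := integral_sum_rotD_mul hα hg hf fun x hx => casimir_extension hn hln hf hfe hx
  simp only [mul_comm (rotD _ g _), mul_comm (g _)] at h2
  by_cases hnm : n = m
  · subst hnm
    have hfg : ∫ x, f x * g x ∂weight α = if k = j ∧ l = l' then 1 else 0 := by
      rw [← integral_wave_mul hα hφ k j hl hln hl' hlm]
      refine integral_congr_ae ?_
      filter_upwards [ae_mem_ball α] with x hx
      rw [hfe x hx, hge x hx]
    rw [hdot, h1, hfg]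
    simp
  · simp only [hnm, and_false, if_false]
    rw [hdot, h1]
    rw [h1] at h2
    have h3 : ((m : ℂ) * (m + 1) - n * (n + 1)) * ∫ x, f x * g x ∂weight α = 0 := by
      linear_combination h2
    have h4 : (m : ℂ) * (m + 1) - n * (n + 1) ≠ 0 := by
      intro h
      have h5 : m * (m + 1) = n * (n + 1) := by exact_mod_cast sub_eq_zero.1 h
      rcases lt_or_gt_of_ne hnm with h6 | h6 <;> nlinarith
    rw [(mul_eq_zero.1 h3).resolve_left h4, mul_zero]

end

end BallPSWF

theorem theorem3p4 (α c : ℝ) (hα : -1 < α) (hc : 0 < c)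
    (φ : ℕ → ℕ → ℝ → ℂ) (lam : ℕ → ℕ → ℝ) (hφ : BallPSWF.IsBallPSWF α c φ lam) :
    -- they are divergence free eigenfunctions of the vectorial finite Fourier transform,
    -- real, smooth, and in the weighted `L²` space
    (∀ n k l : ℕ, 1 ≤ n → 1 ≤ l → l ≤ 2 * n + 1 →
      (∀ x ∈ BallPSWF.ball,
        BallPSWF.finiteFourier α c (BallPSWF.divFreePSWF φ n k l) x =
          ((-Complex.I) ^ (n + 2 * k) * (lam n k : ℂ)) • BallPSWF.divFreePSWF φ n k l x) ∧
      (∀ x ∈ Metric.ball (0 : BallPSWF.E3) 1,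
        BallPSWF.divergence (BallPSWF.divFreePSWF φ n k l) x = 0) ∧
      (∀ x ∈ BallPSWF.ball, ∀ i, (BallPSWF.divFreePSWF φ n k l x i).im = 0) ∧
      ContDiffOn ℝ ∞ (BallPSWF.divFreePSWF φ n k l) BallPSWF.ball ∧
      MemLp (BallPSWF.divFreePSWF φ n k l) 2 (BallPSWF.weight α)) ∧
    -- they are mutually orthogonal, with squared norms `n (n + 1)`
    (∀ n k l m j l' : ℕ, 1 ≤ n → 1 ≤ l → l ≤ 2 * n + 1 → 1 ≤ m → 1 ≤ l' → l' ≤ 2 * m + 1 →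
      ∫ x, BallPSWF.divFreePSWF φ n k l x ⬝ᵥ BallPSWF.divFreePSWF φ m j l' x
          ∂(BallPSWF.weight α) =
        if k = j ∧ l = l' ∧ n = m then (n : ℂ) * ((n : ℂ) + 1) else 0) := by
  refine ⟨fun n k l _ hl hln => ⟨fun x hx => ?_, fun x hx => ?_, fun x hx i => ?_, ?_, ?_⟩,
    fun n k l m j l' hn hl hln hm hl' hlm => ?_⟩
  · exact BallPSWF.finiteFourier_divFreePSWF hα hφ k hl hln hx
  · exact BallPSWF.divergence_divFreePSWF hα hφ k hl hln hx
  · exact BallPSWF.divFreePSWF_im hα hφ k hl hln hx i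
  · exact BallPSWF.contDiffOn_divFreePSWF hα hφ k hl hln
  · exact BallPSWF.memLp_divFreePSWF hα hφ k hl hln
  · exact BallPSWF.integral_divFreePSWF hα hφ k j hn hl hln hm hl' hlm
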